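/- Theorem 3.5 (Gradient of the semigroup). Let $G=(V,w,m)$ be a connected, locally finite weighted graph: $V$ is countable, $w:V^2\to[0,\infty)$ is symmetric and zero on the diagonal, $m:V\to(0,\infty)$, every $x\in V$ has only finitely many neighbours $y\sim x$ (i.e. $w(x,y)>0$), and the combinatorial graph distance $d(x,y)=\inf\{n: x=x_0\sim\dots\sim x_n=y\}$ is finite for all $x,y\in V$. We use the following notation. - $\Delta f(x)=\frac1{m(x)}\sum_{y}w(x,y)(f(y)-f(x))$ for $f:V\to\mathbb R$. - $\|\nabla f\|_\infty=\sup_{x\ne y}\frac{|f(x)-f(y)|}{d(x,y)}\in[0,\infty]$ (equal to $0$ if there are no $x\neq y$); $Lip(1)$ is the set of $f:V\to\mathbb R$ with $|f(x)-f(y)|\le d(x,y)$ for all $x,y$; $\ell_\infty(V)$ and $C_c(V)$ are the sets of bounded and of finitely supported functions $V\to\mathbb R$. - For bounded $f\ge0$, $P_tf$ is the smallest non-negative bounded continuous solution $u(x,t)$, $t\ge0$, of $\partial_tu=\Delta u$, $u(\cdot,0)=f$; for general bounded $f$, $P_tf=P_tf_+-P_tf_-$, where $f_\pm=\max(\pm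 f,0)$. $G$ is stochastically complete if $P_t\mathbf 1=\mathbf 1$ for all $t>0$. The heat kernel is $p_t^x=\frac{m}{m(x)}P_t1_x$. - For probability measures $\mu,\nu$ on $V$, $W(\mu,\nu)=\sup_{f\in Lip(1)\cap\ell_\infty(V)}\left(\int f\,d\mu-\int f\,d\nu\right)\in[0,\infty]$. - For $x\ne y$, $\kappa(x,y)=\lim_{\varepsilon\to0^+}\frac1\varepsilon\left(1-\frac{W(m_x^\varepsilon,m_y^\varepsilon)}{d(x,y)}\right)$, where $m_x^\varepsilon(z)=1_z(x)+\varepsilon\Delta1_z(x)$, which is a finitely supported probability measure for all sufficiently small $\varepsilon>0$. $Ric(G)\ge K$ means that $\kappa(x,y)\ge K$ for all $x\neq y$ (the existence of the limit as a real number being included). Let $K\in\mathbb R$. Then the following statements are equivalent: (1) $Ric(G)\ge K$. (2) For all $f\in C_c(V)$ and all $t>0$, $\|\nabla P_tf\|_\infty\le e^{-Kt}\|\nabla f\|_\infty$. (3) For all $f\in\ell_\infty(V)$ and all $t>0$, $\|\nabla P_tf\|_\infty\le e^{-Kt}\|\nabla f\|_\infty$. (4) $G$ is stochastically complete, and for all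 $x,y\in V$ and all $t>0$, $W(p_t^x,p_t^y)\le e^{-Kt}d(x,y)$. -/

import Mathlib

open Filter Topology

noncomputable section

/-- A weighted graph `(V, w, m)`: a symmetric edge weight `w ≥ 0` vanishing on the diagonal and a
positive vertex measure `m`. -/
structure WeightedGraph (V : Type*) where
  w : V → V → ℝ
  w_nonneg : ∀ x y, 0 ≤ w x y
  w_symm : ∀ x y, w x y = w y x
  w_self : ∀ x, w x x = 0
  m : V → ℝ
  m_pos : ∀ x, 0 < m x

namespace WeightedGraph

variable {V : Type*} (G : WeightedGraph V)

/-- The underlying simple graph: `x ∼ y` iff `w x y > 0`. -/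
def graph : SimpleGraph V where
  Adj x y := 0 < G.w x y
  symm := ⟨fun x y h => by rw [G.w_symm y x]; exact h⟩
  loopless := ⟨fun x h => by rw [G.w_self x] at h; exact lt_irrefl _ h⟩

/-- Every vertex has only finitely many neighbours. -/
def LocallyFinite : Prop := ∀ x, {y | 0 < G.w x y}.Finite

/-- Any two vertices are joined by a path, that is, `d(x, y) < ∞` for all `x, y`. -/
def Connected : Prop := G.graph.Preconnected

/-- The combinatorial graph distance, the least length of a path (on a connected graph). -/
def d (x y : V) : ℝ := (G.graph.dist x y : ℝ)

/-- The graph Laplacian `Δ f(x) = (1 / m(x)) ∑_y w(x,y) (f(y) - f(x))`. The sum is finite on a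
locally finite graph. -/
def laplacian (f : V → ℝ) (x : V) : ℝ := (1 / G.m x) * ∑' y, G.w x y * (f y - f x)

/-- The function `1_x`, equal to `1` at `x` and to `0` elsewhere. -/
def delta (x : V) : V → ℝ := Set.indicator {x} 1

/-- The space `ℓ_∞(V)` of bounded functions. -/
def IsBoundedFun (f : V → ℝ) : Prop := ∃ C : ℝ, ∀ x, |f x| ≤ C

/-- The space `C_c(V)` of finitely supported functions. -/
def IsFinSupp (f : V → ℝ) : Prop := (Function.support f).Finite

/-! ### The heat semigroup -/

/-- `u : [0, ∞) × V → ℝ` is a non-negative bounded continuous solution of the heat equation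
`∂_t u = Δ u` with initial value `f`. Only the values `u t x` with `t ≥ 0` matter, and the time
derivative at `t = 0` is one-sided. -/
structure IsHeatSolution (f : V → ℝ) (u : ℝ → V → ℝ) : Prop where
  nonneg : ∀ t, 0 ≤ t → ∀ x, 0 ≤ u t x
  bounded : ∃ C : ℝ, ∀ t, 0 ≤ t → ∀ x, u t x ≤ C
  cont : ∀ x, ContinuousOn (fun t => u t x) (Set.Ici 0)
  heat : ∀ x, ∀ t, 0 ≤ t →
    HasDerivWithinAt (fun s => u s x) (G.laplacian (u t) x) (Set.Ici 0) t
  init : u 0 = f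

/-- `u` is the smallest non-negative bounded continuous solution with initial value `f`. -/
structure IsLeastHeatSolution (f : V → ℝ) (u : ℝ → V → ℝ) : Prop where
  solution : G.IsHeatSolution f u
  least : ∀ v, G.IsHeatSolution f v → ∀ t, 0 ≤ t → ∀ x, u t x ≤ v t x

/-- The value `P_t f(x)` for bounded `f ≥ 0`: the least value at `(t, x)` of a non-negative bounded
continuous solution with initial value `f`. -/
def heatNonneg (t : ℝ) (f : V → ℝ) (x : V) : ℝ :=
  sInf {r | ∃ u, G.IsHeatSolution f u ∧ r = u t x}

/-- `heatNonneg` is the smallest solution. -/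
theorem heatNonneg_eq {f : V → ℝ} {u : ℝ → V → ℝ} (hu : G.IsLeastHeatSolution f u)
    {t : ℝ} (ht : 0 ≤ t) : G.heatNonneg t f = u t := by
  funext x
  refine IsLeast.csInf_eq ⟨⟨u, hu.solution, rfl⟩, ?_⟩
  rintro r ⟨v, hv, rfl⟩
  exact hu.least v hv t ht x

/-- The heat semigroup `P_t` on bounded functions, extended linearly from non-negative functions
by `P_t f = P_t f₊ - P_t f₋`. -/
def heat (t : ℝ) (f : V → ℝ) (x : V) : ℝ :=
  G.heatNonneg t (fun z => max (f z) 0) x - G.heatNonneg t (fun z => max (-f z) 0) x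

/-- Stochastic completeness (non-explosion): `P_t 1 = 1` for all `t > 0`. -/
def StochasticallyComplete : Prop := ∀ t : ℝ, 0 < t → G.heat t 1 = 1

/-- The (density of the) heat kernel measure `p_t^x = (m / m(x)) P_t 1_x`. -/
def heatKernel (t : ℝ) (x : V) (z : V) : ℝ := G.m z / G.m x * G.heat t (delta x) z

/-! ### Lipschitz functions, Wasserstein distance and curvature -/

/-- `‖∇f‖_∞ = sup_{x ≠ y} |f(x) - f(y)| / d(x,y) ∈ [0, ∞]`. -/
def gradNorm (f : V → ℝ) : ENNReal :=
  ⨆ (x : V) (y : V) (_ : x ≠ y), ENNReal.ofReal (|f x - f y| / G.d x y)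

/-- The set `Lip(1)`. -/
def IsLipOne (f : V → ℝ) : Prop := ∀ x y, |f x - f y| ≤ G.d x y

/-- The Wasserstein distance of two probability measures on `V` given by their point masses,
`W(μ, ν) = sup ∫ f dμ - ∫ f dν` over the bounded functions `f ∈ Lip(1)`. It may be `+∞`. -/
def wasserstein (μ ν : V → ℝ) : EReal :=
  ⨆ (f : V → ℝ) (_ : G.IsLipOne f ∧ IsBoundedFun f),
    ((∑' z, f z * μ z - ∑' z, f z * ν z : ℝ) : EReal)

/-- `m_x^ε(y) = 1_y(x) + ε Δ1_y(x)`, a finitely supported probability measure for small `ε > 0`. -/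
def stepMeasure (ε : ℝ) (x : V) (y : V) : ℝ := delta y x + ε * G.laplacian (delta y) x

/-- `κ_ε(x,y) = 1 - W(m_x^ε, m_y^ε) / d(x,y)`. -/
def curvatureStep (ε : ℝ) (x y : V) : EReal :=
  1 - G.wasserstein (G.stepMeasure ε x) (G.stepMeasure ε y) / (G.d x y : EReal)

/-- The Ollivier curvature `κ(x,y) = lim_{ε → 0+} κ_ε(x,y) / ε` exists and equals `κ`. -/
def HasCurvature (x y : V) (κ : ℝ) : Prop :=
  Tendsto (fun ε : ℝ => G.curvatureStep ε x y / (ε : EReal)) (𝓝[>] 0) (𝓝 (κ : EReal))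

/-- `Ric(G) ≥ K`, that is, `κ(x,y) ≥ K` for all `x ≠ y`. -/
def RicGE (K : ℝ) : Prop := ∀ x y, x ≠ y → ∃ κ : ℝ, G.HasCurvature x y κ ∧ K ≤ κ

end WeightedGraph

end

/-!
The whole argument runs through explicit Euler steps `f + ε Δ f`. Such a step at `x` is the integral
of `f` against `m_x^ε`, so a bound on the Ollivier curvature says precisely that short Euler steps
contract the Lipschitz constant, with rate `1 - Kε` up to an arbitrarily small loss in `K`.

The link with the heat semigroup is `IsEulerScheme.tendsto`. A discrete evolution with values in
`[0, M]` which eventually makes exact Euler steps at every vertex satisfies second order Taylor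
estimates at every vertex, uniformly in the mesh; these survive pointwise limits along ultrafilters
and characterize heat solutions. If the evolution is moreover dominated by every heat solution up to
an error tending to `0`, the limit is the least one, whatever the ultrafilter, so that the evolution
converges to the minimal semigroup. On an infinite graph with unbounded jump rates the steps have to
be confined to balls `B_n` that exhaust the graph while the step length decreases, and the freedom
in doing so is used twice.

* Killing outside `B_n` gives a linear scheme that is symmetric in `ℓ²(m)`. It yields the existence
  of `P_t f`, its linearity in `f`, and the identity `P_t f(x) = ∫ f dp_t^x`
  (`hasSum_mul_heatKernel`), from which the equivalence of the gradient and the transport estimates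
  follows by the definition of `W`.
* Killing destroys Lipschitz bounds at the boundary of `B_n`. Truncating after each step at
  `L e^{-Kt} (n - d(o, ·))₊` restores them, and at a given vertex the truncation is void for large
  `n`, because `f` is bounded. Under `Ric(G) ≥ K` this nonlinear scheme keeps the Lipschitz constant
  below `L e^{-Kt}` and still converges to `P_t f`, which gives the gradient estimate for bounded
  `f ≥ 0` (`RicGE.heatNonneg_sub_le`). Applied to `f = 1`, for every `L > 0`, it shows that `P_t 1` is
  constant in space, hence in time; so adding constants reduces general bounded `f` to `f ≥ 0`.

Conversely, given the gradient estimate on `C_c(V)`, the Taylor estimate at time `0` gives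
`W(m_x^ε, m_y^ε) ≤ e^{-Kε} d(x,y) + O(ε²)`, since only the values of the test function near `x` and
`y` matter and these can be continued to a finitely supported function in `Lip(1)`. The limit
defining `κ(x,y)` exists because `ε ↦ W(m_x^ε, m_y^ε)` is convex (`ricGE_of_eulerStep_sub_le`).
-/

noncomputable section

namespace WeightedGraph

variable {V : Type*} {G : WeightedGraph V}

/-! ### The graph distance -/

theorem d_nonneg (x y : V) : 0 ≤ G.d x y := Nat.cast_nonneg _

theorem d_comm (x y : V) : G.d x y = G.d y x := by
  simp only [d, SimpleGraph.dist_comm]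

theorem d_self (x : V) : G.d x x = 0 := by simp [d]

theorem d_triangle (hconn : G.Connected) (x y z : V) : G.d x z ≤ G.d x y + G.d y z := by
  have : Nonempty V := ⟨x⟩
  have h : G.graph.Connected := ⟨hconn⟩
  simp only [d]
  exact_mod_cast h.dist_triangle

theorem d_pos (hconn : G.Connected) {x y : V} (h : x ≠ y) : 0 < G.d x y := by
  simp only [d]
  exact_mod_cast (hconn x y).pos_dist_of_ne h

theorem abs_d_sub_le (hconn : G.Connected) (z x y : V) : |G.d z x - G.d z y| ≤ G.d x y := by
  rw [abs_le]
  have h1 := d_triangle hconn z x y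
  have h2 := d_triangle hconn z y x
  rw [d_comm y x] at h2
  constructor <;> linarith

theorem finite_setOf_walk_length_le (hfin : G.LocallyFinite) (n : ℕ) (x : V) :
    {y | ∃ p : G.graph.Walk x y, p.length ≤ n}.Finite := by
  induction n generalizing x with
  | zero =>
    refine (Set.finite_singleton x).subset ?_
    rintro y ⟨p, hp⟩
    exact (SimpleGraph.Walk.eq_of_length_eq_zero (Nat.le_zero.1 hp)).symm
  | succ n ih =>
    refine ((Set.finite_singleton x).union ((hfin x).biUnion fun z _ => ih z)).subset ?_
    rintro y ⟨p, hp⟩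
    cases p with
    | nil => exact Or.inl rfl
    | cons h q =>
      refine Or.inr (Set.mem_biUnion h ⟨q, ?_⟩)
      simpa using hp

theorem finite_ball (hfin : G.LocallyFinite) (hconn : G.Connected) (x : V) (r : ℝ) :
    {y | G.d x y ≤ r}.Finite := by
  refine (finite_setOf_walk_length_le hfin ⌈r⌉₊ x).subset fun y hy => ?_
  obtain ⟨p, hp⟩ := (hconn x y).exists_walk_length_eq_dist
  refine ⟨p, ?_⟩
  have h1 : ((G.graph.dist x y : ℕ) : ℝ) ≤ (⌈r⌉₊ : ℝ) := le_trans hy (Nat.le_ceil r)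
  rw [hp]
  exact_mod_cast h1

/-! ### The Laplacian as a finite sum -/

/-- The finite set of neighbours of `x`. -/
def nbrs (hfin : G.LocallyFinite) (x : V) : Finset V := (hfin x).toFinset

/-- The jump rate `w(x,y) / m(x)` from `x` to `y`. -/
def rate (G : WeightedGraph V) (x y : V) : ℝ := G.w x y / G.m x

theorem rate_nonneg (x y : V) : 0 ≤ G.rate x y := div_nonneg (G.w_nonneg x y) (G.m_pos x).le

theorem rate_eq_zero (hfin : G.LocallyFinite) {x y : V} (h : y ∉ nbrs hfin x) :
    G.rate x y = 0 := by
  have : ¬ 0 < G.w x y := by simpa [nbrs] using h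
  simp [rate, le_antisymm (not_lt.1 this) (G.w_nonneg x y)]

theorem laplacian_eq_sum (hfin : G.LocallyFinite) (f : V → ℝ) (x : V) :
    G.laplacian f x = ∑ y ∈ nbrs hfin x, G.rate x y * (f y - f x) := by
  rw [laplacian, tsum_eq_sum (s := nbrs hfin x), Finset.mul_sum]
  · refine Finset.sum_congr rfl fun y _ => ?_
    rw [rate]; ring
  · intro y hy
    have := rate_eq_zero hfin hy
    rw [rate, div_eq_zero_iff] at this
    rw [this.resolve_right (G.m_pos x).ne', zero_mul]

/-- The total jump rate `(1 / m(x)) ∑_y w(x,y)` at `x`. -/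
def rateSum (hfin : G.LocallyFinite) (x : V) : ℝ := ∑ y ∈ nbrs hfin x, G.rate x y

theorem rateSum_nonneg (hfin : G.LocallyFinite) (x : V) : 0 ≤ rateSum hfin x :=
  Finset.sum_nonneg fun _ _ => rate_nonneg _ _

/-- A bound for `Δ²` at `x` on functions with values in `[0, 1]`. -/
def secondRate (hfin : G.LocallyFinite) (x : V) : ℝ :=
  ∑ y ∈ nbrs hfin x, G.rate x y * (rateSum hfin y + rateSum hfin x)

theorem laplacian_add (hfin : G.LocallyFinite) (f g : V → ℝ) (x : V) :
    G.laplacian (fun z => f z + g z) x = G.laplacian f x + G.laplacian g x := by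
  simp only [laplacian_eq_sum hfin, ← Finset.sum_add_distrib]
  exact Finset.sum_congr rfl fun y _ => by ring

theorem laplacian_const_mul (hfin : G.LocallyFinite) (a : ℝ) (f : V → ℝ) (x : V) :
    G.laplacian (fun z => a * f z) x = a * G.laplacian f x := by
  simp only [laplacian_eq_sum hfin, Finset.mul_sum]
  exact Finset.sum_congr rfl fun y _ => by ring

theorem laplacian_congr (hfin : G.LocallyFinite) {f g : V → ℝ} {x : V} (hx : f x = g x)
    (h : ∀ y ∈ nbrs hfin x, f y = g y) : G.laplacian f x = G.laplacian g x := by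
  simp only [laplacian_eq_sum hfin]
  exact Finset.sum_congr rfl fun y hy => by rw [h y hy, hx]

theorem laplacian_eq_zero_of_const (hfin : G.LocallyFinite) {f : V → ℝ} {x : V}
    (h : ∀ y, f y = f x) : G.laplacian f x = 0 := by
  rw [laplacian_eq_sum hfin]
  exact Finset.sum_eq_zero fun y _ => by rw [h y, sub_self, mul_zero]

theorem tendsto_laplacian (hfin : G.LocallyFinite) {ι : Type*} {l : Filter ι} {u : ι → V → ℝ}
    {f : V → ℝ} (h : ∀ y, Tendsto (fun i => u i y) l (𝓝 (f y))) (x : V) :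
    Tendsto (fun i => G.laplacian (u i) x) l (𝓝 (G.laplacian f x)) := by
  simp only [laplacian_eq_sum hfin]
  exact tendsto_finsetSum _ fun y _ => ((h y).sub (h x)).const_mul _

theorem abs_laplacian_le (hfin : G.LocallyFinite) {f : V → ℝ} {M : ℝ} (h0 : ∀ y, 0 ≤ f y)
    (hM : ∀ y, f y ≤ M) (x : V) : |G.laplacian f x| ≤ M * rateSum hfin x := by
  rw [laplacian_eq_sum hfin, rateSum, Finset.mul_sum]
  refine (Finset.abs_sum_le_sum_abs _ _).trans (Finset.sum_le_sum fun y _ => ?_)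
  rw [abs_mul, abs_of_nonneg (rate_nonneg x y), mul_comm]
  refine mul_le_mul_of_nonneg_right ?_ (rate_nonneg x y)
  rw [abs_le]
  constructor <;> linarith [h0 x, h0 y, hM x, hM y]

/-- If every value of `f` moves by at most its total jump rate times `a`, then `Δ f(x)` moves by at
most `secondRate` times `a`. -/
theorem abs_laplacian_sub_le (hfin : G.LocallyFinite) {f g : V → ℝ} {a : ℝ} {x : V}
    (hx : |f x - g x| ≤ rateSum hfin x * a)
    (h : ∀ y ∈ nbrs hfin x, |f y - g y| ≤ rateSum hfin y * a) :
    |G.laplacian f x - G.laplacian g x| ≤ secondRate hfin x * a := by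
  rw [laplacian_eq_sum hfin, laplacian_eq_sum hfin, ← Finset.sum_sub_distrib, secondRate,
    Finset.sum_mul]
  refine (Finset.abs_sum_le_sum_abs _ _).trans (Finset.sum_le_sum fun y hy => ?_)
  rw [← mul_sub, abs_mul, abs_of_nonneg (rate_nonneg x y), mul_assoc]
  refine mul_le_mul_of_nonneg_left ?_ (rate_nonneg x y)
  have e : f y - f x - (g y - g x) = (f y - g y) - (f x - g x) := by ring
  rw [e]
  refine (abs_sub _ _).trans ?_
  linarith [h y hy]

/-! ### The explicit Euler step -/

/-- One explicit Euler step `f + ε Δ f` of the heat equation. -/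
def eulerStep (G : WeightedGraph V) (ε : ℝ) (f : V → ℝ) (x : V) : ℝ := f x + ε * G.laplacian f x

theorem eulerStep_eq (hfin : G.LocallyFinite) (ε : ℝ) (f : V → ℝ) (x : V) :
    G.eulerStep ε f x =
      (1 - ε * rateSum hfin x) * f x + ε * ∑ y ∈ nbrs hfin x, G.rate x y * f y := by
  simp only [eulerStep, laplacian_eq_sum hfin, rateSum, mul_sub, Finset.sum_sub_distrib,
    ← Finset.sum_mul]
  ring

theorem eulerStep_mono (hfin : G.LocallyFinite) {ε : ℝ} (hε : 0 ≤ ε) {f g : V → ℝ}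
    (h : ∀ y, f y ≤ g y) {x : V} (hx : ε * rateSum hfin x ≤ 1) :
    G.eulerStep ε f x ≤ G.eulerStep ε g x := by
  rw [eulerStep_eq hfin, eulerStep_eq hfin]
  refine add_le_add (mul_le_mul_of_nonneg_left (h x) (by linarith))
    (mul_le_mul_of_nonneg_left (Finset.sum_le_sum fun y _ => ?_) hε)
  exact mul_le_mul_of_nonneg_left (h y) (rate_nonneg x y)

theorem eulerStep_const (hfin : G.LocallyFinite) (ε a : ℝ) (x : V) :
    G.eulerStep ε (fun _ => a) x = a := by
  rw [eulerStep, laplacian_eq_zero_of_const hfin fun _ => rfl, mul_zero, add_zero]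

theorem eulerStep_add (hfin : G.LocallyFinite) (ε : ℝ) (f g : V → ℝ) (x : V) :
    G.eulerStep ε (fun z => f z + g z) x = G.eulerStep ε f x + G.eulerStep ε g x := by
  rw [eulerStep, eulerStep, eulerStep, laplacian_add hfin]; ring

theorem eulerStep_const_mul (hfin : G.LocallyFinite) (ε a : ℝ) (f : V → ℝ) (x : V) :
    G.eulerStep ε (fun z => a * f z) x = a * G.eulerStep ε f x := by
  rw [eulerStep, eulerStep, laplacian_const_mul hfin]; ring

/-! ### Second order Taylor estimates and heat solutions -/

/-- Second order Taylor estimates characterize heat solutions. Unlike the heat equation itself they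
are stable under pointwise limits. -/
theorem isHeatSolution_of_taylor {u : ℝ → V → ℝ} {M : ℝ} {C : V → ℝ}
    (h0 : ∀ t, 0 ≤ t → ∀ x, 0 ≤ u t x) (hM : ∀ t, 0 ≤ t → ∀ x, u t x ≤ M)
    (h : ∀ x s t, 0 ≤ s → 0 ≤ t →
      |u s x - u t x - (s - t) * G.laplacian (u t) x| ≤ C x * (s - t) ^ 2) :
    G.IsHeatSolution (u 0) u := by
  have key : ∀ x, ∀ t, 0 ≤ t →
      HasDerivWithinAt (fun s => u s x) (G.laplacian (u t) x) (Set.Ici 0) t := by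
    intro x t ht
    rw [hasDerivWithinAt_iff_isLittleO]
    have h1 : (fun s => u s x - u t x - (s - t) • G.laplacian (u t) x)
        =O[𝓝[Set.Ici 0] t] fun s => (s - t) ^ 2 := by
      refine Asymptotics.IsBigO.of_bound (C x) ?_
      filter_upwards [self_mem_nhdsWithin] with s hs
      rw [Real.norm_eq_abs, smul_eq_mul, Real.norm_of_nonneg (sq_nonneg _)]
      exact h x s t hs ht
    refine h1.trans_isLittleO ?_
    have h2 : (fun s : ℝ => (s - t) ^ 2) =o[𝓝 t] fun s => s - t := by
      have := (Asymptotics.isLittleO_pow_id (𝕜 := ℝ) one_lt_two).comp_tendsto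
        (k := fun s : ℝ => s - t) (l' := 𝓝 t)
        (by simpa using (continuous_id.sub continuous_const).tendsto (f := fun s : ℝ => s - t) t)
      exact this
    exact h2.mono nhdsWithin_le_nhds
  exact ⟨h0, ⟨M, hM⟩, fun x t ht => (key x t ht).continuousWithinAt, key, rfl⟩

theorem IsHeatSolution.abs_sub_le (hfin : G.LocallyFinite) {f : V → ℝ} {u : ℝ → V → ℝ}
    (hu : G.IsHeatSolution f u) {M : ℝ} (hM : ∀ t, 0 ≤ t → ∀ x, u t x ≤ M) (x : V) {s t : ℝ}
    (hs : 0 ≤ s) (ht : 0 ≤ t) : |u s x - u t x| ≤ rateSum hfin x * (M * |s - t|) := by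
  have := (convex_Ici (0 : ℝ)).norm_image_sub_le_of_norm_hasDerivWithin_le
    (f := fun s => u s x) (f' := fun t => G.laplacian (u t) x) (C := M * rateSum hfin x)
    (fun r hr => hu.heat x r hr)
    (fun r hr => abs_laplacian_le hfin (hu.nonneg r hr) (hM r hr) x) ht hs
  simp only [Real.norm_eq_abs] at this
  linarith

theorem IsHeatSolution.taylor (hfin : G.LocallyFinite) {f : V → ℝ} {u : ℝ → V → ℝ}
    (hu : G.IsHeatSolution f u) {M : ℝ} (hM : ∀ t, 0 ≤ t → ∀ x, u t x ≤ M) (x : V) {s t : ℝ}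
    (hs : 0 ≤ s) (ht : 0 ≤ t) :
    |u s x - u t x - (s - t) * G.laplacian (u t) x| ≤ M * secondRate hfin x * (s - t) ^ 2 := by
  have hM0 : 0 ≤ M := (hu.nonneg 0 le_rfl x).trans (hM 0 le_rfl x)
  have hsub : Set.uIcc t s ⊆ Set.Ici 0 := fun r hr => by
    rw [Set.mem_uIcc] at hr
    rcases hr with h | h
    · exact ht.trans h.1
    · exact hs.trans h.1
  have := (convex_uIcc t s).norm_image_sub_le_of_norm_hasDerivWithin_le
    (f := fun r => u r x - r * G.laplacian (u t) x)
    (f' := fun r => G.laplacian (u r) x - G.laplacian (u t) x)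
    (C := secondRate hfin x * (M * |s - t|))
    (fun r hr => ((hu.heat x r (hsub hr)).mono hsub).sub
      (by simpa using (hasDerivWithinAt_id r (Set.uIcc t s)).mul_const (G.laplacian (u t) x)))
    (fun r hr => by
      have hr0 : 0 ≤ r := hsub hr
      have hle : |r - t| ≤ |s - t| := Set.abs_sub_left_of_mem_uIcc hr
      refine abs_laplacian_sub_le hfin ?_ fun y _ => ?_ <;>
      · refine (hu.abs_sub_le hfin hM _ hr0 ht).trans ?_
        exact mul_le_mul_of_nonneg_left (mul_le_mul_of_nonneg_left hle hM0) (rateSum_nonneg _ _))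
    Set.left_mem_uIcc Set.right_mem_uIcc
  simp only [Real.norm_eq_abs] at this
  have e : u s x - u t x - (s - t) * G.laplacian (u t) x
      = u s x - s * G.laplacian (u t) x - (u t x - t * G.laplacian (u t) x) := by ring
  rw [e]
  refine this.trans (le_of_eq ?_)
  rw [← sq_abs (s - t)]
  ring

/-! ### Limits of Euler schemes -/

/-- A family of discrete evolutions `u n k` (`k` counts the time steps of length `ε n`) which
approximates the heat flow from `f`: it takes values in `[0, M]`, its mesh tends to `0`, at every
vertex and up to every time it eventually performs exact Euler steps, and it is asymptotically
dominated by every heat solution with initial value `f`. -/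
structure IsEulerScheme (G : WeightedGraph V) (f : V → ℝ) (M : ℝ) (ε : ℕ → ℝ)
    (u : ℕ → ℕ → V → ℝ) : Prop where
  eps_pos : ∀ n, 0 < ε n
  eps_tendsto : Tendsto ε atTop (𝓝 0)
  nonneg : ∀ n k x, 0 ≤ u n k x
  le : ∀ n k x, u n k x ≤ M
  init : ∀ x, ∀ᶠ n in atTop, u n 0 x = f x
  step : ∀ x T, ∀ᶠ n in atTop, ∀ k : ℕ, k * ε n ≤ T →
    u n (k + 1) x = G.eulerStep (ε n) (u n k) x
  dominated : ∀ v, G.IsHeatSolution f v → ∀ T x, ∀ e > 0, ∀ᶠ n in atTop, ∀ k : ℕ,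
    k * ε n ≤ T → u n k x ≤ v (k * ε n) x + e

theorem abs_euler_sub_le (hfin : G.LocallyFinite) {u : ℕ → V → ℝ} {M ε T : ℝ} (hε : 0 < ε)
    (h0 : ∀ k x, 0 ≤ u k x) (hM : ∀ k x, u k x ≤ M) {x : V}
    (hx : ∀ k : ℕ, k * ε ≤ T → u (k + 1) x = G.eulerStep ε (u k) x)
    {i j : ℕ} (hij : i ≤ j) (hj : j * ε ≤ T) :
    |u j x - u i x| ≤ rateSum hfin x * (M * ((j - i) * ε)) := by
  induction j, hij using Nat.le_induction with
  | base => simp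
  | succ j hij ih =>
    push_cast at hj ⊢
    have hj' : j * ε ≤ T := by nlinarith
    have h1 := ih hj'
    have h2 := abs_laplacian_le hfin (h0 j) (hM j) x
    rw [hx j hj', eulerStep]
    have e : u j x + ε * G.laplacian (u j) x - u i x
        = (u j x - u i x) + ε * G.laplacian (u j) x := by ring
    rw [e]
    refine (abs_add_le _ _).trans ?_
    rw [abs_mul, abs_of_pos hε]
    nlinarith [mul_le_mul_of_nonneg_left h2 hε.le]

/-- The discrete form of `IsHeatSolution.taylor`; it only needs exact Euler steps at `x` and its
neighbours. -/
theorem euler_taylor (hfin : G.LocallyFinite) {u : ℕ → V → ℝ} {M ε T : ℝ} (hε : 0 < ε)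
    (h0 : ∀ k x, 0 ≤ u k x) (hM : ∀ k x, u k x ≤ M) {x : V}
    (hx : ∀ k : ℕ, k * ε ≤ T → u (k + 1) x = G.eulerStep ε (u k) x)
    (hn : ∀ y ∈ nbrs hfin x, ∀ k : ℕ, k * ε ≤ T → u (k + 1) y = G.eulerStep ε (u k) y)
    (i j : ℕ) (hi : i * ε ≤ T) (hj : j * ε ≤ T) :
    |u j x - u i x - (j * ε - i * ε) * G.laplacian (u i) x|
      ≤ M * secondRate hfin x * (j * ε - i * ε) ^ 2 := by
  have hM0 : 0 ≤ M := (h0 0 x).trans (hM 0 x)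
  -- `l` is the index at which the Laplacian is frozen; both ends of `[i, j]` are needed.
  have key : ∀ a b : ℕ, a ≤ b → ∀ l, a ≤ l → l ≤ b → b * ε ≤ T →
      |u b x - u a x - (b * ε - a * ε) * G.laplacian (u l) x|
        ≤ M * secondRate hfin x * (b * ε - a * ε) ^ 2 := by
    intro a b hab l hal hlb hb
    have hosc : ∀ y, (∀ k : ℕ, k * ε ≤ T → u (k + 1) y = G.eulerStep ε (u k) y) →
        ∀ k, a ≤ k → k ≤ b → |u k y - u l y| ≤ rateSum hfin y * (M * (b * ε - a * ε)) := by
      intro y hy k hak hkb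
      have hmul : ∀ {p : ℕ}, p ≤ b → p * ε ≤ T := fun hp =>
        (mul_le_mul_of_nonneg_right (by exact_mod_cast hp) hε.le).trans hb
      have c1 : (a : ℝ) ≤ k := by exact_mod_cast hak
      have c2 : (k : ℝ) ≤ b := by exact_mod_cast hkb
      have c3 : (a : ℝ) ≤ l := by exact_mod_cast hal
      have c4 : (l : ℝ) ≤ b := by exact_mod_cast hlb
      rcases le_total l k with h | h
      · refine (abs_euler_sub_le hfin hε h0 hM hy h (hmul hkb)).trans ?_
        refine mul_le_mul_of_nonneg_left (mul_le_mul_of_nonneg_left ?_ hM0) (rateSum_nonneg _ _)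
        nlinarith
      · rw [abs_sub_comm]
        refine (abs_euler_sub_le hfin hε h0 hM hy h (hmul hlb)).trans ?_
        refine mul_le_mul_of_nonneg_left (mul_le_mul_of_nonneg_left ?_ hM0) (rateSum_nonneg _ _)
        nlinarith
    have hstep : ∀ k, a ≤ k → k ≤ b → |u k x - u a x - (k * ε - a * ε) * G.laplacian (u l) x|
        ≤ (k * ε - a * ε) * (secondRate hfin x * (M * (b * ε - a * ε))) := by
      intro k hak
      induction k, hak using Nat.le_induction with
      | base => intro _; simp
      | succ k hak ih =>
        intro hkb
        have h1 := ih (by omega)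
        have h2 := abs_laplacian_sub_le hfin (hosc x hx k hak (by omega))
          fun y hy => hosc y (hn y hy) k hak (by omega)
        have hk : k * ε ≤ T :=
          (mul_le_mul_of_nonneg_right (by exact_mod_cast (by omega : k ≤ b)) hε.le).trans hb
        rw [hx k hk, eulerStep]
        push_cast
        have e : u k x + ε * G.laplacian (u k) x - u a x
            - ((k + 1) * ε - a * ε) * G.laplacian (u l) x
            = (u k x - u a x - (k * ε - a * ε) * G.laplacian (u l) x)
              + ε * (G.laplacian (u k) x - G.laplacian (u l) x) := by ring
        rw [e]
        refine (abs_add_le _ _).trans ?_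
        rw [abs_mul, abs_of_pos hε]
        nlinarith [mul_le_mul_of_nonneg_left h2 hε.le]
    exact (hstep b hab le_rfl).trans (le_of_eq (by ring))
  rcases le_total i j with h | h
  · exact key i j h i le_rfl h hj
  · have := key j i h i h le_rfl hi
    rw [← abs_neg]
    convert this using 2 <;> ring

theorem natFloor_div_mul_le {t ε : ℝ} (ht : 0 ≤ t) (hε : 0 < ε) : (⌊t / ε⌋₊ : ℝ) * ε ≤ t := by
  have := Nat.floor_le (div_nonneg ht hε.le)
  rwa [le_div_iff₀ hε] at this

theorem tendsto_natFloor_div_mul {ε : ℕ → ℝ} (hε : ∀ n, 0 < ε n) (h : Tendsto ε atTop (𝓝 0))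
    {t : ℝ} (ht : 0 ≤ t) : Tendsto (fun n => (⌊t / ε n⌋₊ : ℝ) * ε n) atTop (𝓝 t) := by
  refine tendsto_of_tendsto_of_tendsto_of_le_of_le (g := fun n => t - ε n) (h := fun _ => t)
    (by simpa using tendsto_const_nhds.sub h) tendsto_const_nhds (fun n => ?_)
    fun n => natFloor_div_mul_le ht (hε n)
  have := Nat.lt_floor_add_one (t / ε n)
  rw [div_lt_iff₀ (hε n)] at this
  simp only
  linarith

/-- Values in a bounded interval converge along every ultrafilter. -/
theorem exists_ultrafilter_lim {ι : Type*} (l : Ultrafilter ι) {M : ℝ} {u : ι → ℝ}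
    (h0 : ∀ i, 0 ≤ u i) (hM : ∀ i, u i ≤ M) : ∃ a, Tendsto u l (𝓝 a) ∧ 0 ≤ a ∧ a ≤ M := by
  obtain ⟨a, ha, hle⟩ := isCompact_Icc.ultrafilter_le_nhds (l.map u)
    (le_principal_iff.2 (mem_map.2 (univ_mem' fun i => ⟨h0 i, hM i⟩ : ∀ᶠ i in l,
      u i ∈ Set.Icc 0 M)))
  exact ⟨a, hle, ha.1, ha.2⟩

/-- Along an ultrafilter an Euler scheme converges to a heat solution, by compactness. -/
theorem IsEulerScheme.exists_lim (hfin : G.LocallyFinite) {f : V → ℝ} {M : ℝ} {ε : ℕ → ℝ}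
    {u : ℕ → ℕ → V → ℝ} (h : G.IsEulerScheme f M ε u) (l : Ultrafilter ℕ) (hl : (l : Filter ℕ) ≤ atTop) :
    ∃ U : ℝ → V → ℝ, G.IsLeastHeatSolution f U ∧ (∀ t x, U t x ≤ M) ∧
      ∀ t, 0 ≤ t → ∀ x, Tendsto (fun n => u n ⌊t / ε n⌋₊ x) l (𝓝 (U t x)) := by
  choose U hU hU0 hUM using fun (t : ℝ) (x : V) =>
    exists_ultrafilter_lim l (u := fun n => u n ⌊t / ε n⌋₊ x) (fun n => h.nonneg n _ x)
      (fun n => h.le n _ x)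
  have hinit : U 0 = f := by
    funext x
    refine tendsto_nhds_unique (hU 0 x) ?_
    refine (tendsto_congr' (hl ?_)).2 tendsto_const_nhds
    filter_upwards [h.init x] with n hn
    simpa using hn
  have hsol : G.IsHeatSolution f U := by
    rw [← hinit]
    refine isHeatSolution_of_taylor (M := M) (C := fun x => M * secondRate hfin x)
      (fun t _ => hU0 t) (fun t _ => hUM t) fun x s t hs ht => ?_
    have hs' := (tendsto_natFloor_div_mul h.eps_pos h.eps_tendsto hs).mono_left hl
    have ht' := (tendsto_natFloor_div_mul h.eps_pos h.eps_tendsto ht).mono_left hl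
    refine le_of_tendsto_of_tendsto
      (((hU s x).sub (hU t x)).sub ((hs'.sub ht').mul
        (tendsto_laplacian hfin (fun y => hU t y) x))).abs
      (((hs'.sub ht').pow 2).const_mul _) (hl ?_)
    filter_upwards [h.step x (max s t), (eventually_all_finset (nbrs hfin x)).2
      fun y _ => h.step y (max s t)] with n h1 h2
    exact euler_taylor hfin (h.eps_pos n) (h.nonneg n) (h.le n) h1 h2 _ _
      ((natFloor_div_mul_le ht (h.eps_pos n)).trans (le_max_right _ _))
      ((natFloor_div_mul_le hs (h.eps_pos n)).trans (le_max_left _ _))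
  refine ⟨U, ⟨hsol, fun v hv t ht x => ?_⟩, hUM, fun t _ x => hU t x⟩
  refine le_of_forall_pos_le_add fun e he => ?_
  have ht' := tendsto_natFloor_div_mul h.eps_pos h.eps_tendsto ht
  have hcont : Tendsto (fun n => v (⌊t / ε n⌋₊ * ε n) x) l (𝓝 (v t x)) := by
    refine ((hv.cont x t ht).tendsto.comp (tendsto_nhdsWithin_iff.2 ⟨ht', ?_⟩)).mono_left hl
    exact Eventually.of_forall fun n => mul_nonneg (Nat.cast_nonneg _) (h.eps_pos n).le
  refine le_of_tendsto_of_tendsto (hU t x) (hcont.add_const e) (hl ?_)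
  filter_upwards [h.dominated v hv t x e he] with n hn
  exact hn _ (natFloor_div_mul_le ht (h.eps_pos n))

/-- An Euler scheme converges to the least heat solution: by minimality the limit does not depend
on the ultrafilter. -/
theorem IsEulerScheme.tendsto (hfin : G.LocallyFinite) {f : V → ℝ} {M : ℝ} {ε : ℕ → ℝ}
    {u : ℕ → ℕ → V → ℝ} (h : G.IsEulerScheme f M ε u) {t : ℝ} (ht : 0 ≤ t) (x : V) :
    Tendsto (fun n => u n ⌊t / ε n⌋₊ x) atTop (𝓝 (G.heatNonneg t f x)) := by
  rw [tendsto_iff_ultrafilter]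
  intro l hl
  obtain ⟨U, hU, -, hlim⟩ := h.exists_lim hfin l hl
  rw [G.heatNonneg_eq hU ht]
  exact hlim t ht x

theorem IsEulerScheme.isLeastHeatSolution (hfin : G.LocallyFinite) {f : V → ℝ} {M : ℝ} {ε : ℕ → ℝ}
    {u : ℕ → ℕ → V → ℝ} (h : G.IsEulerScheme f M ε u) :
    G.IsLeastHeatSolution f (fun t => G.heatNonneg t f) ∧
      ∀ t, 0 ≤ t → ∀ x, G.heatNonneg t f x ≤ M := by
  obtain ⟨U, hU, hM, -⟩ := h.exists_lim hfin (Ultrafilter.of atTop) (Ultrafilter.of_le _)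
  have e : ∀ t, 0 ≤ t → G.heatNonneg t f = U t := fun t ht => G.heatNonneg_eq hU ht
  refine ⟨⟨⟨?_, ⟨M, ?_⟩, ?_, ?_, ?_⟩, ?_⟩, ?_⟩
  · intro t ht x; rw [e t ht]; exact hU.solution.nonneg t ht x
  · intro t ht x; rw [e t ht]; exact hM t x
  · intro x
    exact (hU.solution.cont x).congr fun t ht => congrFun (e t ht) x
  · intro x t ht
    rw [e t ht]
    exact (hU.solution.heat x t ht).congr (fun s hs => congrFun (e s hs) x) (congrFun (e t ht) x)
  · rw [e 0 le_rfl]; exact hU.solution.init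
  · intro v hv t ht x
    rw [e t ht]; exact hU.least v hv t ht x
  · intro t ht x; rw [e t ht]; exact hM t x

/-- A truncated Euler evolution which makes at most a full Euler step on finitely many vertices
`W n`, and vanishes elsewhere after the first step, is asymptotically dominated by the heat
solutions, provided the steps are short compared with the jump rates on `W n`. -/
theorem euler_dominated (hfin : G.LocallyFinite) {f : V → ℝ} {ε : ℕ → ℝ} {W : ℕ → Set V}
    {u : ℕ → ℕ → V → ℝ} (hε : ∀ n, 0 < ε n)
    (hrate : ∀ n, ∀ x ∈ W n, ε n * rateSum hfin x ≤ 1)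
    (hsecond : ∀ n, ∀ x ∈ W n, ε n * secondRate hfin x ≤ 1 / ((n : ℝ) + 1))
    (hinit : ∀ n x, u n 0 x ≤ f x)
    (hin : ∀ n k, ∀ x ∈ W n, u n (k + 1) x ≤ G.eulerStep (ε n) (u n k) x)
    (hout : ∀ n k, ∀ x ∉ W n, u n (k + 1) x ≤ 0)
    {v : ℝ → V → ℝ} (hv : G.IsHeatSolution f v) (T : ℝ) (x : V) {e : ℝ} (he : 0 < e) :
    ∀ᶠ n in atTop, ∀ k : ℕ, k * ε n ≤ T → u n k x ≤ v (k * ε n) x + e := by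
  obtain ⟨M, hM⟩ := hv.bounded
  have hM0 : 0 ≤ M := (hv.nonneg 0 le_rfl x).trans (hM 0 le_rfl x)
  have key : ∀ (n k : ℕ) (x : V),
      u n k x ≤ v (k * ε n) x + k * ε n * (M * (1 / ((n : ℝ) + 1))) := by
    intro n k
    have hn : (0 : ℝ) ≤ 1 / ((n : ℝ) + 1) := by positivity
    induction k with
    | zero =>
      intro x
      simpa [hv.init] using hinit n x
    | succ k ih =>
      intro x
      have hk0 : 0 ≤ k * ε n := mul_nonneg (Nat.cast_nonneg _) (hε n).le
      have hk1 : 0 ≤ ((k + 1 : ℕ) : ℝ) * ε n := mul_nonneg (Nat.cast_nonneg _) (hε n).le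
      by_cases hx : x ∈ W n
      · refine (hin n k x hx).trans ?_
        refine (eulerStep_mono hfin (hε n).le ih (hrate n x hx)).trans ?_
        rw [eulerStep_add hfin, eulerStep_const hfin]
        have h1 := (abs_le.1 (hv.taylor hfin hM x hk1 hk0)).1
        have h2 := mul_le_mul_of_nonneg_left (hsecond n x hx) (mul_nonneg hM0 (hε n).le)
        rw [eulerStep]
        push_cast at h1 ⊢
        nlinarith
      · refine (hout n k x hx).trans (add_nonneg (hv.nonneg _ hk1 x) ?_)
        exact mul_nonneg hk1 (mul_nonneg hM0 hn)
  have hlim : Tendsto (fun n : ℕ => T * (M * (1 / ((n : ℝ) + 1)))) atTop (𝓝 0) := by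
    simpa using (tendsto_one_div_add_atTop_nhds_zero_nat.const_mul M).const_mul T
  filter_upwards [hlim.eventually_lt_const he] with n hn k hk
  refine (key n k x).trans (add_le_add le_rfl (le_trans ?_ hn.le))
  exact mul_le_mul_of_nonneg_right hk (by positivity)

/-! ### The linear scheme and the heat semigroup on bounded functions -/

/-- The ball of radius `n` around `o`. -/
def ballAt (G : WeightedGraph V) (o : V) (n : ℕ) : Set V := {y | G.d o y ≤ n}

theorem eventually_mem_ballAt (o x : V) : ∀ᶠ n in atTop, x ∈ G.ballAt o n := by
  filter_upwards [tendsto_natCast_atTop_atTop.eventually_ge_atTop (G.d o x)] with n hn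
  exact hn

/-- A sequence of time steps which are short compared with the jump rates on growing balls
around `o`. -/
structure IsMesh (hfin : G.LocallyFinite) (o : V) (ε : ℕ → ℝ) : Prop where
  pos : ∀ n, 0 < ε n
  tendsto : Tendsto ε atTop (𝓝 0)
  rate : ∀ n, ∀ x ∈ G.ballAt o n, ε n * rateSum hfin x ≤ 1
  second : ∀ n, ∀ x ∈ G.ballAt o n, ε n * secondRate hfin x ≤ 1 / ((n : ℝ) + 1)

/-- Since balls are finite, meshes exist, with any further condition `P n` that holds for all
sufficiently short time steps. -/
theorem exists_isMesh (hfin : G.LocallyFinite) (hconn : G.Connected) (o : V) {P : ℕ → ℝ → Prop}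
    (hP : ∀ n, ∀ᶠ e in 𝓝[>] 0, P n e) : ∃ ε, IsMesh hfin o ε ∧ ∀ n, P n (ε n) := by
  have hsmall : ∀ a b : ℝ, 0 < b → ∀ᶠ e : ℝ in 𝓝[>] 0, e * a ≤ b := by
    intro a b hb
    have : Tendsto (fun e : ℝ => e * a) (𝓝[>] 0) (𝓝 (0 * a)) :=
      (tendsto_id.mono_left nhdsWithin_le_nhds).mul_const a
    rw [zero_mul] at this
    exact (this.eventually_lt_const hb).mono fun _ h => h.le
  have h : ∀ n : ℕ, ∃ e : ℝ, (0 < e ∧ e ≤ 1 / ((n : ℝ) + 1)) ∧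
      (∀ x ∈ G.ballAt o n, e * rateSum hfin x ≤ 1) ∧
      (∀ x ∈ G.ballAt o n, e * secondRate hfin x ≤ 1 / ((n : ℝ) + 1)) ∧ P n e := by
    intro n
    have hn : (0 : ℝ) < 1 / ((n : ℝ) + 1) := by positivity
    have hW : (G.ballAt o n).Finite := finite_ball hfin hconn o n
    have h1 := (eventually_all_finite hW).2 fun x _ => hsmall (rateSum hfin x) 1 one_pos
    have h2 := (eventually_all_finite hW).2 fun x _ => hsmall (secondRate hfin x) _ hn
    have h3 : ∀ᶠ e : ℝ in 𝓝[>] 0, 0 < e := self_mem_nhdsWithin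
    obtain ⟨e, a1, a2, a3, a4, a5⟩ := (h1.and (h2.and ((hP n).and (h3.and (hsmall 1 _ hn))))).exists
    exact ⟨e, ⟨a4, by simpa using a5⟩, a1, a2, a3⟩
  choose ε h1 h2 h3 h4 using h
  refine ⟨ε, ⟨fun n => (h1 n).1, ?_, h2, h3⟩, h4⟩
  exact squeeze_zero (fun n => (h1 n).1.le) (fun n => (h1 n).2)
    tendsto_one_div_add_atTop_nhds_zero_nat

/-- An Euler step with killing outside `W`. -/
def killStep (G : WeightedGraph V) (W : Set V) (ε : ℝ) (f : V → ℝ) : V → ℝ :=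
  W.indicator (G.eulerStep ε f)

theorem killStep_of_mem {W : Set V} {ε : ℝ} {f : V → ℝ} {x : V} (hx : x ∈ W) :
    G.killStep W ε f x = G.eulerStep ε f x := Set.indicator_of_mem hx _

theorem killStep_of_notMem {W : Set V} {ε : ℝ} {f : V → ℝ} {x : V} (hx : x ∉ W) :
    G.killStep W ε f x = 0 := Set.indicator_of_notMem hx _

theorem killStep_add (hfin : G.LocallyFinite) (W : Set V) (ε : ℝ) (f g : V → ℝ) :
    G.killStep W ε (f + g) = G.killStep W ε f + G.killStep W ε g := by
  funext x
  by_cases hx : x ∈ W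
  · rw [Pi.add_apply, killStep_of_mem hx, killStep_of_mem hx, killStep_of_mem hx]
    exact eulerStep_add hfin ε f g x
  · rw [Pi.add_apply, killStep_of_notMem hx, killStep_of_notMem hx, killStep_of_notMem hx, add_zero]

theorem killStep_smul (hfin : G.LocallyFinite) (W : Set V) (ε a : ℝ) (f : V → ℝ) :
    G.killStep W ε (a • f) = a • G.killStep W ε f := by
  funext x
  by_cases hx : x ∈ W
  · rw [Pi.smul_apply, killStep_of_mem hx, killStep_of_mem hx]
    exact eulerStep_const_mul hfin ε a f x
  · rw [Pi.smul_apply, killStep_of_notMem hx, killStep_of_notMem hx, smul_zero]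

theorem iterate_killStep_add (hfin : G.LocallyFinite) (W : Set V) (ε : ℝ) (f g : V → ℝ) (k : ℕ) :
    (G.killStep W ε)^[k] (f + g) = (G.killStep W ε)^[k] f + (G.killStep W ε)^[k] g := by
  induction k with
  | zero => rfl
  | succ k ih => simp only [Function.iterate_succ_apply', ih, killStep_add hfin]

theorem iterate_killStep_smul (hfin : G.LocallyFinite) (W : Set V) (ε a : ℝ) (f : V → ℝ) (k : ℕ) :
    (G.killStep W ε)^[k] (a • f) = a • (G.killStep W ε)^[k] f := by
  induction k with
  | zero => rfl
  | succ k ih => simp only [Function.iterate_succ_apply', ih, killStep_smul hfin]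

theorem IsMesh.isEulerScheme {hfin : G.LocallyFinite} {o : V} {ε : ℕ → ℝ} (h : IsMesh hfin o ε)
    {f : V → ℝ} {M : ℝ} (h0 : ∀ x, 0 ≤ f x) (hM : ∀ x, f x ≤ M) :
    G.IsEulerScheme f M ε (fun n k => (G.killStep (G.ballAt o n) (ε n))^[k] f) := by
  have hM0 : 0 ≤ M := (h0 o).trans (hM o)
  refine ⟨h.pos, h.tendsto, fun n k => ?_, fun n k => ?_, fun x => Eventually.of_forall fun n => rfl,
    fun x T => ?_, fun v hv T x e he => ?_⟩
  · induction k with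
    | zero => exact h0
    | succ k ih =>
      intro x
      rw [Function.iterate_succ_apply']
      by_cases hx : x ∈ G.ballAt o n
      · rw [killStep_of_mem hx, ← eulerStep_const hfin (ε n) 0 x]
        exact eulerStep_mono hfin (h.pos n).le ih (h.rate n x hx)
      · rw [killStep_of_notMem hx]
  · induction k with
    | zero => exact hM
    | succ k ih =>
      intro x
      rw [Function.iterate_succ_apply']
      by_cases hx : x ∈ G.ballAt o n
      · rw [killStep_of_mem hx]
        refine (eulerStep_mono hfin (h.pos n).le ih (h.rate n x hx)).trans ?_
        rw [eulerStep_const hfin]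
      · rwa [killStep_of_notMem hx]
  · filter_upwards [eventually_mem_ballAt o x] with n hn k _
    rw [Function.iterate_succ_apply', killStep_of_mem hn]
  · refine euler_dominated hfin (W := G.ballAt o)
      (u := fun n k => (G.killStep (G.ballAt o n) (ε n))^[k] f) h.pos h.rate h.second
      (fun n x => le_rfl) (fun n k x hx => ?_) (fun n k x hx => ?_) hv T x he
    · rw [Function.iterate_succ_apply', killStep_of_mem hx]
    · rw [Function.iterate_succ_apply', killStep_of_notMem hx]

theorem isLeastHeatSolution_heatNonneg [Nonempty V] (hfin : G.LocallyFinite) (hconn : G.Connected)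
    {f : V → ℝ} {M : ℝ} (h0 : ∀ x, 0 ≤ f x) (hM : ∀ x, f x ≤ M) :
    G.IsLeastHeatSolution f (fun t => G.heatNonneg t f) ∧
      ∀ t, 0 ≤ t → ∀ x, G.heatNonneg t f x ≤ M := by
  obtain ⟨ε, hε, -⟩ := exists_isMesh hfin hconn (Classical.arbitrary V) (P := fun _ _ => True)
    fun n => Eventually.of_forall fun _ => trivial
  exact (hε.isEulerScheme h0 hM).isLeastHeatSolution hfin

theorem heatNonneg_zero (hfin : G.LocallyFinite) {t : ℝ} (ht : 0 ≤ t) :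
    G.heatNonneg t (fun _ => 0) = fun _ => 0 := by
  refine G.heatNonneg_eq (u := fun _ _ => 0) ⟨?_, fun v hv t ht x => hv.nonneg t ht x⟩ ht
  exact ⟨fun _ _ _ => le_rfl, ⟨0, fun _ _ _ => le_rfl⟩, fun _ => continuousOn_const,
    fun x t _ => by
      rw [laplacian_eq_zero_of_const hfin fun _ => rfl]
      exact hasDerivWithinAt_const _ _ _, rfl⟩

theorem heat_of_nonneg (hfin : G.LocallyFinite) {f : V → ℝ} (h0 : ∀ x, 0 ≤ f x) {t : ℝ}
    (ht : 0 ≤ t) : G.heat t f = G.heatNonneg t f := by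
  funext x
  have h1 : (fun z => max (f z) 0) = f := funext fun z => max_eq_left (h0 z)
  have h2 : (fun z => max (-f z) 0) = fun _ => 0 :=
    funext fun z => max_eq_right (neg_nonpos.2 (h0 z))
  rw [heat, h1, h2, heatNonneg_zero hfin ht, sub_zero]

theorem IsMesh.tendsto_heat {hfin : G.LocallyFinite} {o : V} {ε : ℕ → ℝ} (h : IsMesh hfin o ε)
    {f : V → ℝ} (hf : IsBoundedFun f) {t : ℝ} (ht : 0 ≤ t) (x : V) :
    Tendsto (fun n => (G.killStep (G.ballAt o n) (ε n))^[⌊t / ε n⌋₊] f x) atTop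
      (𝓝 (G.heat t f x)) := by
  obtain ⟨C, hC⟩ := hf
  have hC0 : 0 ≤ C := (abs_nonneg _).trans (hC o)
  have h1 := (h.isEulerScheme (f := fun z => max (f z) 0) (M := C) (fun z => le_max_right _ _)
    fun z => max_le ((le_abs_self _).trans (hC z)) hC0).tendsto hfin ht x
  have h2 := (h.isEulerScheme (f := fun z => max (-f z) 0) (M := C) (fun z => le_max_right _ _)
    fun z => max_le ((neg_le_abs _).trans (hC z)) hC0).tendsto hfin ht x
  refine (h1.sub h2).congr fun n => ?_
  have e : f = (fun z => max (f z) 0) + (-1 : ℝ) • fun z => max (-f z) 0 := by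
    funext z
    simp only [Pi.add_apply, Pi.smul_apply, smul_eq_mul]
    rcases le_total 0 (f z) with hz | hz
    · rw [max_eq_left hz, max_eq_right (by linarith)]; ring
    · rw [max_eq_right hz, max_eq_left (by linarith)]; ring
  conv_rhs => rw [e, iterate_killStep_add hfin, iterate_killStep_smul hfin]
  simp only [Pi.add_apply, Pi.smul_apply, smul_eq_mul]
  ring

theorem IsBoundedFun.add {f g : V → ℝ} (hf : IsBoundedFun f) (hg : IsBoundedFun g) :
    IsBoundedFun (f + g) := by
  obtain ⟨C, hC⟩ := hf
  obtain ⟨D, hD⟩ := hg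
  exact ⟨C + D, fun x => (abs_add_le _ _).trans (add_le_add (hC x) (hD x))⟩

theorem IsBoundedFun.smul {f : V → ℝ} (hf : IsBoundedFun f) (a : ℝ) : IsBoundedFun (a • f) := by
  obtain ⟨C, hC⟩ := hf
  refine ⟨|a| * C, fun x => ?_⟩
  rw [Pi.smul_apply, smul_eq_mul, abs_mul]
  exact mul_le_mul_of_nonneg_left (hC x) (abs_nonneg a)

theorem isBoundedFun_of_mem {f : V → ℝ} {M : ℝ} (h0 : ∀ x, 0 ≤ f x) (hM : ∀ x, f x ≤ M) :
    IsBoundedFun f := ⟨M, fun x => by rw [abs_of_nonneg (h0 x)]; exact hM x⟩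

theorem heat_add (hfin : G.LocallyFinite) (hconn : G.Connected) {f g : V → ℝ}
    (hf : IsBoundedFun f) (hg : IsBoundedFun g) {t : ℝ} (ht : 0 ≤ t) :
    G.heat t (f + g) = G.heat t f + G.heat t g := by
  funext x
  obtain ⟨ε, hε, -⟩ := exists_isMesh hfin hconn x (P := fun _ _ => True)
    fun n => Eventually.of_forall fun _ => trivial
  refine tendsto_nhds_unique (hε.tendsto_heat (hf.add hg) ht x)
    (((hε.tendsto_heat hf ht x).add (hε.tendsto_heat hg ht x)).congr fun n => ?_)
  rw [iterate_killStep_add hfin, Pi.add_apply]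

theorem heat_smul (hfin : G.LocallyFinite) (hconn : G.Connected) {f : V → ℝ}
    (hf : IsBoundedFun f) (a : ℝ) {t : ℝ} (ht : 0 ≤ t) :
    G.heat t (a • f) = a • G.heat t f := by
  funext x
  obtain ⟨ε, hε, -⟩ := exists_isMesh hfin hconn x (P := fun _ _ => True)
    fun n => Eventually.of_forall fun _ => trivial
  refine tendsto_nhds_unique (hε.tendsto_heat (hf.smul a) ht x)
    (((hε.tendsto_heat hf ht x).const_mul a).congr fun n => ?_)
  rw [iterate_killStep_smul hfin, Pi.smul_apply, smul_eq_mul]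

/-! ### The heat kernel -/

theorem delta_self (x : V) : delta x x = 1 := by simp [delta]

theorem delta_of_ne {x y : V} (h : y ≠ x) : delta x y = 0 := by simp [delta, h]

theorem delta_nonneg (x y : V) : 0 ≤ delta x y := Set.indicator_nonneg (fun _ _ => zero_le_one) y

theorem delta_le_one (x y : V) : delta x y ≤ 1 := by
  by_cases h : y = x
  · rw [h, delta_self]
  · rw [delta_of_ne h]; exact zero_le_one

theorem isBoundedFun_delta (x : V) : IsBoundedFun (delta x) :=
  isBoundedFun_of_mem (delta_nonneg x) (delta_le_one x)

theorem isBoundedFun_sum {F : Finset V} {g : V → V → ℝ} (h : ∀ z, IsBoundedFun (g z)) :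
    IsBoundedFun (∑ z ∈ F, g z) := by
  classical
  induction F using Finset.induction_on with
  | empty => exact ⟨0, fun x => by simp⟩
  | insert z F hz ih => rw [Finset.sum_insert hz]; exact (h z).add ih

theorem heat_sum (hfin : G.LocallyFinite) (hconn : G.Connected) (F : Finset V) {g : V → V → ℝ}
    (h : ∀ z, IsBoundedFun (g z)) {t : ℝ} (ht : 0 ≤ t) :
    G.heat t (∑ z ∈ F, g z) = ∑ z ∈ F, G.heat t (g z) := by
  classical
  induction F using Finset.induction_on with
  | empty =>
    rw [Finset.sum_empty, Finset.sum_empty,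
      heat_of_nonneg (f := (0 : V → ℝ)) hfin (fun _ => le_rfl) ht]
    exact heatNonneg_zero hfin ht
  | insert z F hz ih =>
    rw [Finset.sum_insert hz, Finset.sum_insert hz, heat_add hfin hconn (h z)
      (isBoundedFun_sum h) ht, ih]

/-- The killed Euler step is symmetric in `ℓ²(m)`. -/
theorem killStep_symm (hfin : G.LocallyFinite) (F : Finset V) (ε : ℝ) {f g : V → ℝ}
    (hf : ∀ x ∉ F, f x = 0) (hg : ∀ x ∉ F, g x = 0) :
    ∑ a ∈ F, G.m a * G.killStep F ε f a * g a = ∑ a ∈ F, G.m a * f a * G.killStep F ε g a := by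
  have key : ∀ {f : V → ℝ}, (∀ x ∉ F, f x = 0) → ∀ a ∈ F, G.m a * G.killStep F ε f a =
      G.m a * (1 - ε * rateSum hfin a) * f a + ε * ∑ y ∈ F, G.w a y * f y := by
    intro f hf a ha
    have e : ∑ y ∈ nbrs hfin a, G.rate a y * f y = ∑ y ∈ F, G.rate a y * f y := by
      classical
      rw [Finset.sum_subset (Finset.subset_union_left (s₁ := nbrs hfin a) (s₂ := F)),
        Finset.sum_subset (Finset.subset_union_right (s₁ := nbrs hfin a) (s₂ := F))]
      · intro y _ hy; rw [hf y hy, mul_zero]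
      · intro y _ hy; rw [rate_eq_zero hfin hy, zero_mul]
    have e' : G.m a * ∑ y ∈ F, G.rate a y * f y = ∑ y ∈ F, G.w a y * f y := by
      rw [Finset.mul_sum]
      refine Finset.sum_congr rfl fun y _ => ?_
      rw [rate, ← mul_assoc, mul_div_cancel₀ _ (G.m_pos a).ne']
    rw [killStep_of_mem (Finset.mem_coe.2 ha), eulerStep_eq hfin, e, mul_add, mul_left_comm _ ε, e',
      mul_assoc]
  have h1 : ∀ a ∈ F, G.m a * G.killStep F ε f a * g a =
      G.m a * (1 - ε * rateSum hfin a) * (f a * g a) + ∑ y ∈ F, ε * (G.w a y * f y * g a) := by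
    intro a ha
    rw [key hf a ha, add_mul, mul_assoc _ (f a), mul_assoc ε, Finset.sum_mul, Finset.mul_sum]
  have h2 : ∀ a ∈ F, G.m a * f a * G.killStep F ε g a =
      G.m a * (1 - ε * rateSum hfin a) * (f a * g a) + ∑ y ∈ F, ε * (G.w a y * g y * f a) := by
    intro a ha
    rw [mul_right_comm, key hg a ha, add_mul, mul_assoc _ (g a), mul_comm (g a), mul_assoc ε,
      Finset.sum_mul, Finset.mul_sum]
  rw [Finset.sum_congr rfl h1, Finset.sum_congr rfl h2, Finset.sum_add_distrib,
    Finset.sum_add_distrib]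
  refine congrArg₂ _ rfl ?_
  rw [Finset.sum_comm]
  refine Finset.sum_congr rfl fun y _ => Finset.sum_congr rfl fun a _ => ?_
  rw [G.w_symm a y]; ring

theorem iterate_killStep_symm (hfin : G.LocallyFinite) (F : Finset V) (ε : ℝ) (k : ℕ)
    {f g : V → ℝ} (hf : ∀ x ∉ F, f x = 0) (hg : ∀ x ∉ F, g x = 0) :
    ∑ a ∈ F, G.m a * (G.killStep F ε)^[k] f a * g a
      = ∑ a ∈ F, G.m a * f a * (G.killStep F ε)^[k] g a := by
  have hz : ∀ {f : V → ℝ}, ∀ x ∉ F, G.killStep F ε f x = 0 := fun x hx =>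
    killStep_of_notMem (by simpa using hx)
  induction k generalizing g with
  | zero => rfl
  | succ k ih =>
    rw [Function.iterate_succ_apply (x := g), ← ih hz, Function.iterate_succ_apply',
      killStep_symm hfin F ε _ hg]
    intro x hx
    cases k with
    | zero => exact hf x hx
    | succ k => rw [Function.iterate_succ_apply']; exact hz x hx

/-- The symmetry of the heat kernel with respect to `m`, inherited from the killed scheme. -/
theorem heat_delta_symm (hfin : G.LocallyFinite) (hconn : G.Connected) (x z : V) {t : ℝ}
    (ht : 0 ≤ t) : G.m z * G.heat t (delta x) z = G.m x * G.heat t (delta z) x := by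
  obtain ⟨ε, hε, -⟩ := exists_isMesh hfin hconn x (P := fun _ _ => True)
    fun n => Eventually.of_forall fun _ => trivial
  refine tendsto_nhds_unique ((hε.tendsto_heat (isBoundedFun_delta x) ht z).const_mul _)
    (((hε.tendsto_heat (isBoundedFun_delta z) ht x).const_mul _).congr' ?_)
  filter_upwards [eventually_mem_ballAt x x, eventually_mem_ballAt x z] with n hx hz
  have hW : (G.ballAt x n).Finite := finite_ball hfin hconn x n
  have hd : ∀ y ∈ G.ballAt x n, ∀ a ∉ hW.toFinset, delta y a = 0 := fun y hy a ha =>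
    delta_of_ne fun h => ha (by rw [h]; simpa using hy)
  have := iterate_killStep_symm hfin hW.toFinset (ε n) ⌊t / ε n⌋₊ (hd x hx) (hd z hz)
  rw [Set.Finite.coe_toFinset] at this
  rw [Finset.sum_eq_single z, Finset.sum_eq_single x, delta_self, delta_self, mul_one,
    mul_one] at this
  · exact this.symm
  · intro b _ hb; rw [delta_of_ne hb]; ring
  · intro h; exact absurd (hW.mem_toFinset.2 hx) h
  · intro b _ hb; rw [delta_of_ne hb]; ring
  · intro h; exact absurd (hW.mem_toFinset.2 hz) h

theorem heatKernel_eq (hfin : G.LocallyFinite) (hconn : G.Connected) (x z : V) {t : ℝ}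
    (ht : 0 ≤ t) : G.heatKernel t x z = G.heat t (delta z) x := by
  rw [heatKernel, div_mul_eq_mul_div, heat_delta_symm hfin hconn x z ht,
    mul_div_cancel_left₀ _ (G.m_pos x).ne']

theorem heatNonneg_mono (hfin : G.LocallyFinite) (hconn : G.Connected)
    {f g : V → ℝ} {M : ℝ} (h0 : ∀ x, 0 ≤ g x) (hgf : ∀ x, g x ≤ f x) (hM : ∀ x, f x ≤ M)
    {t : ℝ} (ht : 0 ≤ t) (x : V) : G.heatNonneg t g x ≤ G.heatNonneg t f x := by
  have : Nonempty V := ⟨x⟩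
  have hd0 : ∀ x, 0 ≤ (f - g) x := fun x => sub_nonneg.2 (hgf x)
  have hdM : ∀ x, (f - g) x ≤ M := fun x => (sub_le_self _ (h0 x)).trans (hM x)
  have h := heat_add hfin hconn (isBoundedFun_of_mem h0 fun x => (hgf x).trans (hM x))
    (isBoundedFun_of_mem hd0 hdM) ht
  rw [add_sub_cancel, heat_of_nonneg hfin (fun x => (h0 x).trans (hgf x)) ht,
    heat_of_nonneg hfin h0 ht, heat_of_nonneg hfin hd0 ht] at h
  rw [h]
  exact le_add_of_nonneg_right
    ((isLeastHeatSolution_heatNonneg hfin hconn hd0 hdM).1.solution.nonneg t ht x)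

/-- The semigroup is continuous along increasing approximations from below: the limit along an
ultrafilter is a heat solution, hence at least the least one. -/
theorem tendsto_heatNonneg [Nonempty V] (hfin : G.LocallyFinite) (hconn : G.Connected)
    {ι : Type*} {l : Filter ι} {g : ι → V → ℝ} {f : V → ℝ} {M : ℝ} (h0 : ∀ i x, 0 ≤ g i x)
    (hgf : ∀ i x, g i x ≤ f x) (hM : ∀ x, f x ≤ M)
    (hg : ∀ x, Tendsto (fun i => g i x) l (𝓝 (f x))) {t : ℝ} (ht : 0 ≤ t) (x : V) :
    Tendsto (fun i => G.heatNonneg t (g i) x) l (𝓝 (G.heatNonneg t f x)) := by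
  rw [tendsto_iff_ultrafilter]
  intro p hp
  have hgM : ∀ i x, g i x ≤ M := fun i x => (hgf i x).trans (hM x)
  have hsol := fun i => isLeastHeatSolution_heatNonneg hfin hconn (h0 i) (hgM i)
  -- Heat solutions are only controlled at times `t ≥ 0`, whence the `max t 0`.
  choose U hU hU0 hUM using fun (t : ℝ) (x : V) =>
    exists_ultrafilter_lim p (u := fun i => G.heatNonneg (max t 0) (g i) x)
      (fun i => (hsol i).1.solution.nonneg _ (le_max_right _ _) x)
      (fun i => (hsol i).2 _ (le_max_right _ _) x)
  have hU' : ∀ t, 0 ≤ t → ∀ x, Tendsto (fun i => G.heatNonneg t (g i) x) p (𝓝 (U t x)) := by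
    intro t ht x
    simpa only [max_eq_left ht] using hU t x
  have hinit : U 0 = f := by
    funext x
    refine tendsto_nhds_unique (hU' 0 le_rfl x) (((hg x).mono_left hp).congr fun i => ?_)
    exact (congrFun (hsol i).1.solution.init x).symm
  have hUsol : G.IsHeatSolution f U := by
    rw [← hinit]
    refine isHeatSolution_of_taylor (M := M) (C := fun x => M * secondRate hfin x)
      (fun t _ => hU0 t) (fun t _ => hUM t) fun x s t hs ht => ?_
    refine le_of_tendsto ((((hU' s hs x).sub (hU' t ht x)).sub
      ((tendsto_laplacian hfin (hU' t ht) x).const_mul (s - t)))).abs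
      (Eventually.of_forall fun i => ?_)
    exact (hsol i).1.solution.taylor hfin (hsol i).2 x hs ht
  have hf0 : ∀ x, 0 ≤ f x := fun x =>
    ge_of_tendsto' ((hg x).mono_left hp) fun i => h0 i x
  have hlow := (isLeastHeatSolution_heatNonneg hfin hconn hf0 hM).1.least U hUsol t ht x
  have hup : U t x ≤ G.heatNonneg t f x :=
    le_of_tendsto (hU' t ht x) (Eventually.of_forall fun i =>
      heatNonneg_mono hfin hconn (h0 i) (hgf i) hM ht x)
  rw [le_antisymm hlow hup]
  exact hU' t ht x

theorem hasSum_mul_heatKernel_of_nonneg (hfin : G.LocallyFinite) (hconn : G.Connected)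
    {f : V → ℝ} {M : ℝ} (h0 : ∀ x, 0 ≤ f x) (hM : ∀ x, f x ≤ M) {t : ℝ} (ht : 0 ≤ t) (x : V) :
    HasSum (fun z => f z * G.heatKernel t x z) (G.heatNonneg t f x) := by
  classical
  have : Nonempty V := ⟨x⟩
  have hval : ∀ (F : Finset V) (y : V),
      (∑ z ∈ F, f z • delta z) y = if y ∈ F then f y else 0 := by
    intro F y
    simp only [Finset.sum_apply, Pi.smul_apply, smul_eq_mul]
    split_ifs with hy
    · rw [Finset.sum_eq_single_of_mem y hy fun z _ hz => by rw [delta_of_ne hz.symm, mul_zero],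
        delta_self, mul_one]
    · exact Finset.sum_eq_zero fun z hz => by
        rw [delta_of_ne fun h => hy (by rwa [h]), mul_zero]
  have hF0 : ∀ (F : Finset V) (y : V), 0 ≤ (∑ z ∈ F, f z • delta z) y := by
    intro F y; rw [hval]; split_ifs
    exacts [h0 y, le_rfl]
  have hFf : ∀ (F : Finset V) (y : V), (∑ z ∈ F, f z • delta z) y ≤ f y := by
    intro F y; rw [hval]; split_ifs
    exacts [le_rfl, h0 y]
  refine (tendsto_heatNonneg hfin hconn (l := atTop) hF0 hFf hM (fun y => ?_) ht x).congr
    fun F => ?_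
  · refine tendsto_const_nhds.congr' ?_
    filter_upwards [eventually_ge_atTop {y}] with F hF
    rw [hval, if_pos (hF (Finset.mem_singleton_self y))]
  · rw [← heat_of_nonneg hfin (hF0 F) ht,
      heat_sum hfin hconn F (fun z => (isBoundedFun_delta z).smul (f z)) ht, Finset.sum_apply]
    refine Finset.sum_congr rfl fun z _ => ?_
    simp only
    rw [heat_smul hfin hconn (isBoundedFun_delta z) _ ht, heatKernel_eq hfin hconn x z ht,
      Pi.smul_apply, smul_eq_mul]

/-- `P_t f(x) = ∫ f dp_t^x`. -/
theorem hasSum_mul_heatKernel (hfin : G.LocallyFinite) (hconn : G.Connected)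
    {f : V → ℝ} (hf : IsBoundedFun f) {t : ℝ} (ht : 0 ≤ t) (x : V) :
    HasSum (fun z => f z * G.heatKernel t x z) (G.heat t f x) := by
  obtain ⟨C, hC⟩ := hf
  have hC0 : 0 ≤ C := (abs_nonneg _).trans (hC x)
  have h1 := hasSum_mul_heatKernel_of_nonneg hfin hconn (f := fun z => max (f z) 0) (M := C)
    (fun z => le_max_right _ _) (fun z => max_le ((le_abs_self _).trans (hC z)) hC0) ht x
  have h2 := hasSum_mul_heatKernel_of_nonneg hfin hconn (f := fun z => max (-f z) 0) (M := C)
    (fun z => le_max_right _ _) (fun z => max_le ((neg_le_abs _).trans (hC z)) hC0) ht x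
  have e : (fun z => f z * G.heatKernel t x z) = fun z =>
      max (f z) 0 * G.heatKernel t x z - max (-f z) 0 * G.heatKernel t x z := by
    funext z
    rw [← sub_mul, max_zero_sub_max_neg_zero_eq_self]
  rw [e]
  exact h1.sub h2

/-! ### Curvature and contraction of Euler steps -/

theorem tsum_mul_stepMeasure (hfin : G.LocallyFinite) (f : V → ℝ) (ε : ℝ) (x : V) :
    ∑' z, f z * G.stepMeasure ε x z = G.eulerStep ε f x := by
  have hδ : ∀ y, HasSum (fun z => f z * delta z y) (f y) := by
    intro y
    have := hasSum_single (f := fun z => f z * delta z y) y fun z hz => by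
      simp only [delta_of_ne hz.symm, mul_zero]
    simpa only [delta_self, mul_one] using this
  have hsum := (hδ x).add ((hasSum_sum fun y (_ : y ∈ nbrs hfin x) =>
    ((hδ y).sub (hδ x)).mul_left (G.rate x y)).mul_left ε)
  rw [eulerStep, laplacian_eq_sum hfin, ← hsum.tsum_eq]
  refine tsum_congr fun z => ?_
  rw [stepMeasure, laplacian_eq_sum hfin, mul_add, mul_left_comm, Finset.mul_sum (a := f z)]
  refine congrArg (fun r => f z * delta z x + ε * r) (Finset.sum_congr rfl fun y _ => ?_)
  ring

theorem le_wasserstein_stepMeasure (hfin : G.LocallyFinite) {f : V → ℝ} (hf : G.IsLipOne f)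
    (hb : IsBoundedFun f) (ε : ℝ) (x y : V) :
    ((G.eulerStep ε f x - G.eulerStep ε f y : ℝ) : EReal)
      ≤ G.wasserstein (G.stepMeasure ε x) (G.stepMeasure ε y) := by
  rw [← tsum_mul_stepMeasure hfin, ← tsum_mul_stepMeasure hfin]
  exact le_iSup₂_of_le f ⟨hf, hb⟩ le_rfl

/-- A lower curvature bound says that short Euler steps contract the Lipschitz constant, up to an
arbitrarily small loss `δ` in the rate. -/
theorem RicGE.eventually_eulerStep_sub_le (hfin : G.LocallyFinite) (hconn : G.Connected) {K : ℝ}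
    (h : G.RicGE K) (x y : V) {δ : ℝ} (hδ : 0 < δ) :
    ∀ᶠ ε : ℝ in 𝓝[>] 0, ∀ f, G.IsLipOne f → IsBoundedFun f →
      G.eulerStep ε f x - G.eulerStep ε f y ≤ (1 - (K - δ) * ε) * G.d x y := by
  rcases eq_or_ne x y with rfl | hxy
  · exact Eventually.of_forall fun ε f _ _ => by rw [d_self]; simp
  obtain ⟨κ, hκ, hK⟩ := h x y hxy
  have hlt : ((K - δ : ℝ) : EReal) < κ := EReal.coe_lt_coe_iff.2 (by linarith)
  filter_upwards [hκ.eventually_const_lt hlt, self_mem_nhdsWithin] with ε h1 (hε : 0 < ε) f hf hb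
  have hd := d_pos hconn hxy
  have h2 : G.curvatureStep ε x y / (ε : EReal) ≤
      (((1 - (G.eulerStep ε f x - G.eulerStep ε f y) / G.d x y) / ε : ℝ) : EReal) := by
    rw [EReal.coe_div, EReal.coe_sub, EReal.coe_div, EReal.coe_one]
    refine EReal.div_le_div_right_of_nonneg (EReal.coe_nonneg.2 hε.le) ?_
    exact EReal.sub_le_sub le_rfl (EReal.div_le_div_right_of_nonneg (EReal.coe_nonneg.2 hd.le)
      (le_wasserstein_stepMeasure hfin hf hb ε x y))
  have h3 := EReal.coe_lt_coe_iff.1 (h1.trans_le h2)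
  rw [lt_div_iff₀ hε, lt_sub_comm, div_lt_iff₀ hd] at h3
  exact h3.le

theorem isLipOne_inv_smul {L : ℝ} (hL : 0 < L) {f : V → ℝ}
    (hf : ∀ p q, f p - f q ≤ L * G.d p q) : G.IsLipOne (L⁻¹ • f) := by
  intro p q
  have h := hf q p
  rw [d_comm] at h
  simp only [Pi.smul_apply, smul_eq_mul]
  rw [← mul_sub, abs_mul, abs_of_pos (inv_pos.2 hL), inv_mul_le_iff₀ hL, abs_le]
  exact ⟨by linarith, hf p q⟩

theorem eulerStep_sub_le_of_lip (hfin : G.LocallyFinite) {ε a L : ℝ} {x y : V} (hL : 0 < L)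
    (h : ∀ f, G.IsLipOne f → IsBoundedFun f →
      G.eulerStep ε f x - G.eulerStep ε f y ≤ a * G.d x y)
    {f : V → ℝ} (hf : ∀ p q, f p - f q ≤ L * G.d p q) (hb : IsBoundedFun f) :
    G.eulerStep ε f x - G.eulerStep ε f y ≤ L * a * G.d x y := by
  have h1 := h (L⁻¹ • f) (isLipOne_inv_smul hL hf) (hb.smul _)
  have e : ∀ p, G.eulerStep ε (L⁻¹ • f) p = L⁻¹ * G.eulerStep ε f p := fun p =>
    eulerStep_const_mul hfin ε L⁻¹ f p
  rw [e, e, ← mul_sub, inv_mul_le_iff₀ hL] at h1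
  linarith

/-! ### The Lipschitz cutoff scheme -/

/-- The cutoff `(n - d(o, ·))₊`, a function in `Lip(1)` supported in the ball of radius `n`. -/
def cutoff (G : WeightedGraph V) (o : V) (n : ℕ) (x : V) : ℝ := max (n - G.d o x) 0

theorem cutoff_nonneg (o : V) (n : ℕ) (x : V) : 0 ≤ G.cutoff o n x := le_max_right _ _

theorem cutoff_of_notMem {o : V} {n : ℕ} {x : V} (hx : x ∉ G.ballAt o n) : G.cutoff o n x = 0 :=
  max_eq_right (sub_nonpos.2 (not_le.1 hx).le)

theorem cutoff_sub_le (hconn : G.Connected) (o : V) (n : ℕ) (x y : V) :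
    G.cutoff o n x - G.cutoff o n y ≤ G.d x y := by
  have h := (abs_le.1 (abs_d_sub_le hconn o x y)).1
  rw [sub_le_iff_le_add, cutoff]
  refine max_le ?_ (add_nonneg (d_nonneg _ _) (cutoff_nonneg _ _ _))
  have := le_max_left ((n : ℝ) - G.d o y) 0
  rw [cutoff]
  linarith

/-- Euler steps with killing outside the ball of radius `n`, followed each time by a truncation
at `L e^{-K t}` times the cutoff function. The truncation restores the Lipschitz bound across the
boundary of the ball, where killing would destroy it. -/
def lipEuler (G : WeightedGraph V) (o : V) (n : ℕ) (K L ε : ℝ) (f : V → ℝ) : ℕ → V → ℝ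
  | 0 => fun x => min (f x) (L * G.cutoff o n x)
  | k + 1 => (G.ballAt o n).indicator fun x =>
      min (G.eulerStep ε (lipEuler G o n K L ε f k) x)
        (L * Real.exp (-K * ((k + 1 : ℕ) * ε)) * G.cutoff o n x)

section

variable {o : V} {n : ℕ} {K L ε : ℝ} {f : V → ℝ}

theorem lipEuler_succ_of_mem {x : V} (hx : x ∈ G.ballAt o n) (k : ℕ) :
    G.lipEuler o n K L ε f (k + 1) x = min (G.eulerStep ε (G.lipEuler o n K L ε f k) x)
      (L * Real.exp (-K * ((k + 1 : ℕ) * ε)) * G.cutoff o n x) := Set.indicator_of_mem hx _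

theorem lipEuler_succ_of_notMem {x : V} (hx : x ∉ G.ballAt o n) (k : ℕ) :
    G.lipEuler o n K L ε f (k + 1) x = 0 := Set.indicator_of_notMem hx _

theorem lipEuler_nonneg (hfin : G.LocallyFinite) (hL : 0 < L) (hε : 0 < ε)
    (hrate : ∀ x ∈ G.ballAt o n, ε * rateSum hfin x ≤ 1) (h0 : ∀ x, 0 ≤ f x) (k : ℕ) (x : V) :
    0 ≤ G.lipEuler o n K L ε f k x := by
  have hc := G.cutoff_nonneg o n
  induction k generalizing x with
  | zero => exact le_min (h0 x) (mul_nonneg hL.le (hc x))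
  | succ k ih =>
    by_cases hx : x ∈ G.ballAt o n
    · rw [lipEuler_succ_of_mem hx]
      refine le_min ?_ (mul_nonneg (by positivity) (hc x))
      rw [← eulerStep_const hfin ε 0 x]
      exact eulerStep_mono hfin hε.le ih (hrate x hx)
    · rw [lipEuler_succ_of_notMem hx]

theorem lipEuler_le (hfin : G.LocallyFinite) (hε : 0 < ε)
    (hrate : ∀ x ∈ G.ballAt o n, ε * rateSum hfin x ≤ 1) {M : ℝ} (hM0 : 0 ≤ M)
    (hM : ∀ x, f x ≤ M) (k : ℕ) (x : V) : G.lipEuler o n K L ε f k x ≤ M := by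
  induction k generalizing x with
  | zero => exact (min_le_left _ _).trans (hM x)
  | succ k ih =>
    by_cases hx : x ∈ G.ballAt o n
    · rw [lipEuler_succ_of_mem hx]
      refine (min_le_left _ _).trans ((eulerStep_mono hfin hε.le ih (hrate x hx)).trans ?_)
      rw [eulerStep_const hfin]
    · rwa [lipEuler_succ_of_notMem hx]

theorem min_sub_min_le {a b a' b' c : ℝ} (h : a - a' ≤ c) (h' : b - b' ≤ c) :
    min a b - min a' b' ≤ c := by
  rcases min_cases a' b' with ⟨e, -⟩ | ⟨e, -⟩ <;> rw [e]
  · linarith [min_le_left a b]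
  · linarith [min_le_right a b]

theorem lipEuler_sub_le (hfin : G.LocallyFinite) (hconn : G.Connected) (hL : 0 < L) (hε : 0 < ε)
    (hrate : ∀ x ∈ G.ballAt o n, ε * rateSum hfin x ≤ 1) {M : ℝ} (h0 : ∀ x, 0 ≤ f x)
    (hM : ∀ x, f x ≤ M) (hf : ∀ x y, f x - f y ≤ L * G.d x y)
    (hcontr : ∀ x ∈ G.ballAt o n, ∀ y ∈ G.ballAt o n, ∀ g, G.IsLipOne g → IsBoundedFun g →
      G.eulerStep ε g x - G.eulerStep ε g y ≤ (1 - K * ε) * G.d x y) (k : ℕ) (x y : V) :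
    G.lipEuler o n K L ε f k x - G.lipEuler o n K L ε f k y
      ≤ L * Real.exp (-K * (k * ε)) * G.d x y := by
  have hM0 : 0 ≤ M := (h0 o).trans (hM o)
  have hnn := lipEuler_nonneg (K := K) hfin hL hε hrate h0
  have hc : ∀ a : ℝ, 0 ≤ a → ∀ x y, a * G.cutoff o n x - a * G.cutoff o n y ≤ a * G.d x y := by
    intro a ha x y
    rw [← mul_sub]
    exact mul_le_mul_of_nonneg_left (cutoff_sub_le hconn o n x y) ha
  induction k generalizing x y with
  | zero =>
    simp only [Nat.cast_zero, zero_mul, mul_zero, Real.exp_zero, mul_one]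
    exact min_sub_min_le (hf x y) (hc L hL.le x y)
  | succ k ih =>
    have hpos : 0 < L * Real.exp (-K * ((k + 1 : ℕ) * ε)) := by positivity
    by_cases hx : x ∈ G.ballAt o n
    · by_cases hy : y ∈ G.ballAt o n
      · rw [lipEuler_succ_of_mem hx, lipEuler_succ_of_mem hy]
        refine min_sub_min_le ?_ (hc _ hpos.le x y)
        have hpos' : 0 < L * Real.exp (-K * (k * ε)) := by positivity
        refine (eulerStep_sub_le_of_lip hfin hpos' (hcontr x hx y hy) ih (isBoundedFun_of_mem
          (hnn k) (lipEuler_le hfin hε hrate hM0 hM k))).trans ?_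
        refine mul_le_mul_of_nonneg_right ?_ (d_nonneg x y)
        have e : -K * ((k + 1 : ℕ) * ε) = -K * (k * ε) + -K * ε := by push_cast; ring
        rw [e, Real.exp_add, ← mul_assoc L]
        refine mul_le_mul_of_nonneg_left ?_ hpos'.le
        -- The Euler factor `1 - Kε` is at most `e^{-Kε}`.
        linarith [Real.add_one_le_exp (-K * ε)]
      · -- The truncation bounds the jump across the boundary of the ball.
        rw [lipEuler_succ_of_mem hx, lipEuler_succ_of_notMem hy, sub_zero]
        refine (min_le_right _ _).trans ?_
        have := hc _ hpos.le x y
        rwa [cutoff_of_notMem hy, mul_zero, sub_zero] at this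
    · rw [lipEuler_succ_of_notMem hx]
      linarith [hnn (k + 1) y, mul_nonneg hpos.le (d_nonneg (G := G) x y)]

end

/-- The cutoff scheme converges to the minimal semigroup. The rate `κ n` may depend on `n`, which
absorbs the loss in `RicGE.eventually_eulerStep_sub_le`. -/
theorem isEulerScheme_lipEuler {hfin : G.LocallyFinite} {o : V} {ε : ℕ → ℝ}
    (h : IsMesh hfin o ε) {K L M : ℝ} {κ : ℕ → ℝ} (hκ : ∀ n, κ n ≤ K) (hL : 0 < L) {f : V → ℝ}
    (h0 : ∀ x, 0 ≤ f x) (hM : ∀ x, f x ≤ M) :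
    G.IsEulerScheme f M ε (fun n k => G.lipEuler o n (κ n) L (ε n) f k) := by
  have hM0 : 0 ≤ M := (h0 o).trans (hM o)
  -- Far from the boundary of the ball the truncation is void, since the values stay below `M`.
  have hlarge : ∀ (x : V) (a : ℝ), 0 < a → ∀ᶠ n : ℕ in atTop, M ≤ a * G.cutoff o n x := by
    intro x a ha
    filter_upwards [tendsto_natCast_atTop_atTop.eventually_ge_atTop (M / a + G.d o x)] with n hn
    have : M / a ≤ G.cutoff o n x := le_max_of_le_left (by linarith)
    rwa [div_le_iff₀' ha] at this
  have hle := fun n => lipEuler_le (K := κ n) (L := L) hfin (h.pos n) (h.rate n) hM0 hM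
  refine ⟨h.pos, h.tendsto,
    fun n k => lipEuler_nonneg hfin hL (h.pos n) (h.rate n) h0 k, hle,
    fun x => ?_, fun x T => ?_, fun v hv T x e he => ?_⟩
  · filter_upwards [hlarge x L hL] with n hn
    exact min_eq_left ((hM x).trans hn)
  · filter_upwards [hlarge x (L * Real.exp (-(|K| * (T + 1)))) (by positivity),
      eventually_mem_ballAt o x, h.tendsto.eventually_lt_const one_pos] with n h1 h2 h3 k hk
    rw [lipEuler_succ_of_mem h2]
    refine min_eq_left ?_
    refine ((eulerStep_mono hfin (h.pos n).le (hle n k) (h.rate n x h2)).trans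
      (eulerStep_const hfin (ε n) M x).le).trans (h1.trans ?_)
    refine mul_le_mul_of_nonneg_right ?_ (cutoff_nonneg o n x)
    refine mul_le_mul_of_nonneg_left (Real.exp_le_exp.2 ?_) hL.le
    have hk0 : 0 ≤ ((k + 1 : ℕ) : ℝ) * ε n := mul_nonneg (Nat.cast_nonneg _) (h.pos n).le
    have hk1 : ((k + 1 : ℕ) : ℝ) * ε n ≤ T + 1 := by push_cast; linarith
    have := mul_le_mul ((hκ n).trans (le_abs_self K)) hk1 hk0 (abs_nonneg K)
    linarith
  · refine euler_dominated hfin (W := G.ballAt o)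
      (u := fun n k => G.lipEuler o n (κ n) L (ε n) f k) h.pos h.rate h.second
      (fun n x => min_le_left _ _) (fun n k x hx => ?_) (fun n k x hx => ?_) hv T x he
    · rw [lipEuler_succ_of_mem hx]
      exact min_le_left _ _
    · exact (lipEuler_succ_of_notMem hx k).le

/-- The gradient estimate for non-negative bounded functions. -/
theorem RicGE.heatNonneg_sub_le (hfin : G.LocallyFinite) (hconn : G.Connected) {K : ℝ}
    (h : G.RicGE K) {f : V → ℝ} {L M : ℝ} (hL : 0 < L) (h0 : ∀ x, 0 ≤ f x) (hM : ∀ x, f x ≤ M)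
    (hf : ∀ x y, f x - f y ≤ L * G.d x y) {t : ℝ} (ht : 0 ≤ t) (x y : V) :
    G.heatNonneg t f x - G.heatNonneg t f y ≤ L * Real.exp (-K * t) * G.d x y := by
  let κ : ℕ → ℝ := fun n => K - 1 / ((n : ℝ) + 1)
  have hpos : ∀ n : ℕ, (0 : ℝ) < 1 / ((n : ℝ) + 1) := fun n => by positivity
  obtain ⟨ε, hε, hcontr⟩ := exists_isMesh hfin hconn x (P := fun n e =>
      ∀ p ∈ G.ballAt x n, ∀ q ∈ G.ballAt x n, ∀ g, G.IsLipOne g → IsBoundedFun g →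
        G.eulerStep e g p - G.eulerStep e g q ≤ (1 - κ n * e) * G.d p q) fun n => by
    have hW : (G.ballAt x n).Finite := finite_ball hfin hconn x n
    exact (eventually_all_finite hW).2 fun p _ => (eventually_all_finite hW).2 fun q _ =>
      h.eventually_eulerStep_sub_le hfin hconn p q (hpos n)
  have hs := isEulerScheme_lipEuler hε (κ := κ) (fun n => sub_le_self K (hpos n).le) hL h0 hM
  have hκ : Tendsto κ atTop (𝓝 K) := by
    simpa [κ] using (tendsto_const_nhds (x := K)).sub
      (tendsto_one_div_add_atTop_nhds_zero_nat (𝕜 := ℝ))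
  have hexp : Tendsto (fun n => Real.exp (-κ n * (⌊t / ε n⌋₊ * ε n))) atTop
      (𝓝 (Real.exp (-K * t))) :=
    (Real.continuous_exp.tendsto _).comp
      (hκ.neg.mul (tendsto_natFloor_div_mul hε.pos hε.tendsto ht))
  refine le_of_tendsto_of_tendsto' ((hs.tendsto hfin ht x).sub (hs.tendsto hfin ht y))
    ((hexp.const_mul L).mul_const (G.d x y)) fun n => ?_
  exact lipEuler_sub_le hfin hconn hL (hε.pos n) (hε.rate n) h0 hM hf (hcontr n) _ x y

/-! ### From gradient estimates to curvature -/

theorem gradNorm_le_ofReal_iff (hconn : G.Connected) {f : V → ℝ} {L : ℝ} (hL : 0 ≤ L) :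
    G.gradNorm f ≤ ENNReal.ofReal L ↔ ∀ x y, f x - f y ≤ L * G.d x y := by
  simp only [gradNorm, iSup_le_iff, ENNReal.ofReal_le_ofReal_iff hL]
  constructor
  · intro h x y
    rcases eq_or_ne x y with rfl | hxy
    · rw [d_self]; simp
    · have := h x y hxy
      rw [div_le_iff₀ (d_pos hconn hxy)] at this
      exact (le_abs_self _).trans this
  · intro h x y hxy
    rw [div_le_iff₀ (d_pos hconn hxy), abs_le]
    have := h y x
    rw [d_comm] at this
    exact ⟨by linarith, h x y⟩

/-- Near finitely many prescribed vertices, a function in `Lip(1)` agrees up to a constant with a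
finitely supported function in `Lip(1)` whose supremum is controlled by these vertices alone. -/
theorem exists_finSupp_eq_add (hfin : G.LocallyFinite) (hconn : G.Connected) (o : V) {r : ℝ}
    (hr : 0 ≤ r) {f : V → ℝ} (hf : G.IsLipOne f) :
    ∃ (g : V → ℝ) (c : ℝ), IsFinSupp g ∧ (∀ p q, g p - g q ≤ G.d p q) ∧ (∀ p, 0 ≤ g p) ∧
      (∀ p, g p ≤ 3 * r) ∧ ∀ p, G.d o p ≤ r → g p = f p + c := by
  have hpq : ∀ p q, f p - f q ≤ G.d p q := fun p q => (abs_le.1 (hf p q)).2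
  refine ⟨fun p => max 0 (min (f p + (r - f o)) (3 * r - G.d o p)), r - f o, ?_, fun p q => ?_,
    fun p => le_max_left _ _, fun p => ?_, fun p hp => ?_⟩
  · refine (finite_ball hfin hconn o (3 * r)).subset fun p hp => ?_
    by_contra hp'
    refine hp (max_eq_left ((min_le_right _ _).trans ?_))
    linarith [lt_of_not_ge (show ¬ G.d o p ≤ 3 * r from hp')]
  · have h1 : min (f p + (r - f o)) (3 * r - G.d o p) - min (f q + (r - f o)) (3 * r - G.d o q)
        ≤ G.d p q := by
      refine min_sub_min_le (by linarith [hpq p q]) ?_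
      linarith [(abs_le.1 (abs_d_sub_le hconn o p q)).1]
    rw [sub_le_iff_le_add]
    refine max_le (add_nonneg (d_nonneg _ _) (le_max_left _ _)) ?_
    linarith [le_max_right 0 (min (f q + (r - f o)) (3 * r - G.d o q))]
  · exact max_le (by linarith) ((min_le_right _ _).trans (by linarith [G.d_nonneg o p]))
  · have h1 := hpq o p
    have h2 := hpq p o
    rw [d_comm] at h2
    simp only
    rw [min_eq_left (by linarith), max_eq_right (by linarith)]

/-- The gradient estimate on `C_c(V)` contracts Euler steps, with an error of second order in `ε`
that is uniform over the bounded functions in `Lip(1)`. -/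
theorem exists_eulerStep_sub_le (hfin : G.LocallyFinite) (hconn : G.Connected) {K : ℝ}
    (h : ∀ f : V → ℝ, IsFinSupp f → ∀ t : ℝ, 0 < t →
      G.gradNorm (G.heat t f) ≤ ENNReal.ofReal (Real.exp (-K * t)) * G.gradNorm f) (x y : V) :
    ∃ C, ∀ ε : ℝ, 0 < ε → ∀ f, G.IsLipOne f →
      G.eulerStep ε f x - G.eulerStep ε f y ≤ Real.exp (-K * ε) * G.d x y + C * ε ^ 2 := by
  have : Nonempty V := ⟨x⟩
  obtain ⟨r, hr⟩ : ∃ r : ℝ, ∀ p ∈ (insert x (nbrs hfin x : Set V)) ∪ insert y (nbrs hfin y : Set V),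
      G.d x p ≤ r := by
    have hF : ((insert x (nbrs hfin x : Set V)) ∪ insert y (nbrs hfin y : Set V)).Finite :=
      ((Finset.finite_toSet _).insert _).union ((Finset.finite_toSet _).insert _)
    obtain ⟨r, hr⟩ := (hF.image (G.d x)).bddAbove
    exact ⟨r, fun p hp => hr (Set.mem_image_of_mem _ hp)⟩
  have hr0 : 0 ≤ r := (d_nonneg x x).trans (hr x (Or.inl (Set.mem_insert _ _)))
  refine ⟨3 * r * secondRate hfin x + 3 * r * secondRate hfin y, fun ε hε f hf => ?_⟩
  obtain ⟨g, c, hg, hlip, hg0, hgM, hgf⟩ := exists_finSupp_eq_add hfin hconn x hr0 hf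
  have hstep : ∀ p, G.d x p ≤ r → (∀ q ∈ nbrs hfin p, G.d x q ≤ r) →
      G.eulerStep ε g p = G.eulerStep ε f p + c := by
    intro p hp hq
    rw [← eulerStep_const hfin ε c p, ← eulerStep_add hfin, eulerStep, eulerStep, hgf p hp,
      laplacian_congr hfin (g := fun z => f z + c) (hgf p hp) fun q hq' => hgf q (hq q hq')]
  have hx := hstep x (hr x (Or.inl (Set.mem_insert _ _)))
    fun q hq => hr q (Or.inl (Set.mem_insert_of_mem _ hq))
  have hy := hstep y (hr y (Or.inr (Set.mem_insert _ _)))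
    fun q hq => hr q (Or.inr (Set.mem_insert_of_mem _ hq))
  obtain ⟨hsol, hM⟩ := isLeastHeatSolution_heatNonneg hfin hconn hg0 hgM
  have htay : ∀ p, |G.heatNonneg ε g p - G.eulerStep ε g p| ≤
      3 * r * secondRate hfin p * ε ^ 2 := by
    intro p
    have := hsol.solution.taylor hfin hM p hε.le le_rfl
    have e : G.heatNonneg 0 g = g := hsol.solution.init
    rw [e, sub_zero] at this
    rwa [eulerStep, ← sub_sub]
  have hgrad : G.heatNonneg ε g x - G.heatNonneg ε g y ≤ Real.exp (-K * ε) * G.d x y := by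
    rw [← heat_of_nonneg hfin hg0 hε.le]
    refine (gradNorm_le_ofReal_iff hconn (Real.exp_pos _).le).1 ((h g hg ε hε).trans ?_) x y
    have h1 : G.gradNorm g ≤ ENNReal.ofReal 1 :=
      (gradNorm_le_ofReal_iff hconn zero_le_one).2 fun p q => by rw [one_mul]; exact hlip p q
    calc _ ≤ ENNReal.ofReal (Real.exp (-K * ε)) * ENNReal.ofReal 1 := by gcongr
      _ = _ := by rw [ENNReal.ofReal_one, mul_one]
  have h1 := (abs_le.1 (htay x)).1
  have h2 := (abs_le.1 (htay y)).2
  linarith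

/-- `W(m_x^ε, m_y^ε)` as a real supremum. -/
theorem exists_isLUB_stepMeasure (hfin : G.LocallyFinite) {K : ℝ} {C : ℝ}
    {x y : V} (hC : ∀ ε : ℝ, 0 < ε → ∀ f, G.IsLipOne f →
      G.eulerStep ε f x - G.eulerStep ε f y ≤ Real.exp (-K * ε) * G.d x y + C * ε ^ 2)
    {ε : ℝ} (hε : 0 < ε) :
    ∃ W : ℝ, G.wasserstein (G.stepMeasure ε x) (G.stepMeasure ε y) = W ∧
      (∀ f, G.IsLipOne f → IsBoundedFun f → G.eulerStep ε f x - G.eulerStep ε f y ≤ W) ∧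
      (∀ b, (∀ f, G.IsLipOne f → IsBoundedFun f →
        G.eulerStep ε f x - G.eulerStep ε f y ≤ b) → W ≤ b) := by
  have hle : ∀ b : ℝ, (∀ f, G.IsLipOne f → IsBoundedFun f →
      G.eulerStep ε f x - G.eulerStep ε f y ≤ b) →
      G.wasserstein (G.stepMeasure ε x) (G.stepMeasure ε y) ≤ b := by
    intro b hb
    refine iSup₂_le fun f hf => ?_
    rw [tsum_mul_stepMeasure hfin, tsum_mul_stepMeasure hfin]
    exact EReal.coe_le_coe_iff.2 (hb f hf.1 hf.2)
  have htop := ne_top_of_le_ne_top (EReal.coe_ne_top _) (hle _ fun f hf _ => hC ε hε f hf)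
  have hbot := ne_bot_of_le_ne_bot (EReal.coe_ne_bot _)
    (le_wasserstein_stepMeasure (G := G) hfin (f := fun _ => 0)
      (fun p q => by simpa using d_nonneg p q) ⟨0, fun _ => by simp⟩ ε x y)
  have e := EReal.coe_toReal htop hbot
  refine ⟨_, e.symm, fun f hf hb => ?_, fun b hb => ?_⟩
  · have := le_wasserstein_stepMeasure hfin hf hb ε x y
    rwa [← e, EReal.coe_le_coe_iff] at this
  · have := hle b hb
    rwa [← e, EReal.coe_le_coe_iff] at this

/-- The limit defining the curvature exists because `ε ↦ W(m_x^ε, m_y^ε)`, a supremum of affine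
functions of `ε` with value `d(x,y)` at `0`, is convex, so that its difference quotients at `0` are
monotone. -/
theorem ricGE_of_eulerStep_sub_le (hfin : G.LocallyFinite) (hconn : G.Connected) {K : ℝ}
    (h : ∀ x y, ∃ C, ∀ ε : ℝ, 0 < ε → ∀ f, G.IsLipOne f →
      G.eulerStep ε f x - G.eulerStep ε f y ≤ Real.exp (-K * ε) * G.d x y + C * ε ^ 2) :
    G.RicGE K := by
  intro x y hxy
  obtain ⟨C, hC⟩ := h x y
  have hd := d_pos hconn hxy
  choose! W hWeq hW hWle using fun (ε : ℝ) (hε : 0 < ε) => exists_isLUB_stepMeasure hfin hC hε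
  let φ : ℝ → ℝ := fun ε => (1 - W ε / G.d x y) / ε
  have hφ : ∀ ε, 0 < ε → G.curvatureStep ε x y / (ε : EReal) = (φ ε : EReal) := by
    intro ε hε
    rw [curvatureStep, hWeq ε hε, EReal.coe_div, EReal.coe_sub, EReal.coe_div, EReal.coe_one]
  have hanti : AntitoneOn φ (Set.Ioi 0) := by
    intro a (ha : 0 < a) b (hb : 0 < b) hab
    -- An affine function of `ε` which is at most `d` at `0` and at most `W b` at `b`.
    have hconv : W a ≤ (1 - a / b) * G.d x y + a / b * W b := by
      refine hWle a ha _ fun f hf hbd => ?_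
      have h1 := hW b hb f hf hbd
      have h2 := (abs_le.1 (hf x y)).2
      have hab1 : a / b ≤ 1 := (div_le_one hb).2 hab
      have e : G.eulerStep a f x - G.eulerStep a f y
          = (1 - a / b) * (f x - f y) + a / b * (G.eulerStep b f x - G.eulerStep b f y) := by
        simp only [eulerStep]
        field_simp
        ring
      rw [e]
      exact add_le_add (mul_le_mul_of_nonneg_left h2 (by linarith))
        (mul_le_mul_of_nonneg_left h1 (by positivity))
    have hconv' : W a / G.d x y ≤ (1 - a / b) + a / b * (W b / G.d x y) := by
      rw [div_le_iff₀ hd]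
      refine hconv.trans (le_of_eq ?_)
      field_simp
    show (1 - W b / G.d x y) / b ≤ (1 - W a / G.d x y) / a
    rw [le_div_iff₀ ha]
    have e : (1 - W b / G.d x y) / b * a = a / b - a / b * (W b / G.d x y) := by ring
    linarith
  have hbdd : BddAbove (φ '' Set.Ioi 0) := by
    -- A single test function with `f x - f y = d(x, y)` bounds all difference quotients.
    let f : V → ℝ := fun z => min (G.d x y) (G.d y z)
    have hf : ∀ p q, f p - f q ≤ G.d p q := fun p q =>
      min_sub_min_le (by linarith [G.d_nonneg p q]) ((abs_le.1 (abs_d_sub_le hconn y p q)).2)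
    have hf1 : G.IsLipOne f := fun p q => abs_le.2
      ⟨by have := hf q p; rw [d_comm] at this; linarith, hf p q⟩
    have hfb : IsBoundedFun f := isBoundedFun_of_mem
      (fun z => le_min (d_nonneg _ _) (d_nonneg _ _)) fun z => min_le_left _ _
    have hx : f x = G.d x y := by simp only [f, d_comm y x, min_self]
    have hy : f y = 0 := by simp only [f, d_self, min_eq_right (d_nonneg x y)]
    refine ⟨-(G.laplacian f x - G.laplacian f y) / G.d x y, ?_⟩
    rintro _ ⟨ε, hε : 0 < ε, rfl⟩
    have h1 := hW ε hε f hf1 hfb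
    rw [eulerStep, eulerStep, hx, hy] at h1
    show (1 - W ε / G.d x y) / ε ≤ _
    rw [div_le_div_iff₀ hε hd, sub_mul, div_mul_cancel₀ _ hd.ne']
    linarith
  refine ⟨_, ((continuous_coe_real_ereal.tendsto _).comp
    (hanti.tendsto_nhdsGT hbdd)).congr' ?_, ?_⟩
  · filter_upwards [self_mem_nhdsWithin] with ε hε
    exact (hφ ε hε).symm
  · have hexp : Tendsto (fun ε : ℝ => -(ε⁻¹ * (Real.exp (-K * ε) - 1)) - C / G.d x y * ε)
        (𝓝[>] 0) (𝓝 (-(-K) - C / G.d x y * 0)) := by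
      refine Tendsto.sub (Tendsto.neg ?_) ((tendsto_id.mono_left nhdsWithin_le_nhds).const_mul _)
      have hder : HasDerivAt (fun ε : ℝ => Real.exp (-K * ε)) (-K) 0 := by
        simpa using ((hasDerivAt_id (0 : ℝ)).const_mul (-K)).exp
      have := (hasDerivAt_iff_tendsto_slope_zero.1 hder).mono_left
        (nhdsGT_le_nhdsNE (0 : ℝ))
      simpa using this
    rw [neg_neg, mul_zero, sub_zero] at hexp
    refine le_of_tendsto_of_tendsto hexp (hanti.tendsto_nhdsGT hbdd) ?_
    filter_upwards [self_mem_nhdsWithin] with ε (hε : 0 < ε)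
    have h1 := hWle ε hε _ fun f hf _ => hC ε hε f hf
    show _ ≤ (1 - W ε / G.d x y) / ε
    rw [le_div_iff₀ hε]
    have h2 : W ε / G.d x y ≤ Real.exp (-K * ε) + C / G.d x y * ε ^ 2 := by
      rw [div_le_iff₀ hd]
      refine h1.trans (le_of_eq ?_)
      field_simp
    have e : (-(ε⁻¹ * (Real.exp (-K * ε) - 1)) - C / G.d x y * ε) * ε
        = 1 - Real.exp (-K * ε) - C / G.d x y * ε ^ 2 := by
      field_simp
      ring
    rw [e]
    linarith

/-! ### Stochastic completeness and gradient estimates -/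

theorem isBoundedFun_one : IsBoundedFun (1 : V → ℝ) := ⟨1, fun x => by simp⟩

/-- If `P_t 1` is spatially constant at every time, then it does not change in time. -/
theorem stochasticallyComplete_of_const (hfin : G.LocallyFinite) (hconn : G.Connected)
    (h : ∀ t : ℝ, 0 < t → ∀ x y, G.heatNonneg t 1 x ≤ G.heatNonneg t 1 y) :
    G.StochasticallyComplete := by
  intro t ht
  rw [heat_of_nonneg (f := 1) hfin (fun _ => zero_le_one) ht.le]
  funext x
  have : Nonempty V := ⟨x⟩
  obtain ⟨hsol, -⟩ := isLeastHeatSolution_heatNonneg (G := G) (f := 1) (M := 1) hfin hconn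
    (fun _ => zero_le_one) fun _ => le_rfl
  have hinit : G.heatNonneg 0 1 = (1 : V → ℝ) := hsol.solution.init
  have hlap : ∀ s, 0 ≤ s → G.laplacian (G.heatNonneg s 1) x = 0 := by
    intro s hs
    refine laplacian_eq_zero_of_const hfin fun y => ?_
    rcases hs.eq_or_lt with rfl | hs
    · rw [hinit]; rfl
    · exact le_antisymm (h s hs y x) (h s hs x y)
  have := (convex_Ici (0 : ℝ)).norm_image_sub_le_of_norm_hasDerivWithin_le (C := 0)
    (fun r hr => hsol.solution.heat x r hr)
    (fun r hr => by simp only [hlap r hr, norm_zero, le_refl]) (Set.self_mem_Ici (a := (0 : ℝ))) ht.le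
  rw [zero_mul, norm_le_zero_iff, hinit] at this
  exact sub_eq_zero.1 this

/-- A gradient estimate may be checked against all strict upper bounds of `‖∇f‖_∞`. -/
theorem gradNorm_le_mul_of_forall_lt (hconn : G.Connected) {f g : V → ℝ} {a : ℝ} (ha : 0 < a)
    (h : ∀ L : ℝ, 0 < L → (∀ x y, f x - f y ≤ L * G.d x y) → ∀ x y, g x - g y ≤ L * a * G.d x y) :
    G.gradNorm g ≤ ENNReal.ofReal a * G.gradNorm f := by
  rcases eq_or_ne (G.gradNorm f) ⊤ with htop | htop
  · rw [htop, ENNReal.mul_top (by simpa using ha)]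
    exact le_top
  have e := ENNReal.ofReal_toReal htop
  have h0 : 0 ≤ (G.gradNorm f).toReal := ENNReal.toReal_nonneg
  rw [← e, ← ENNReal.ofReal_mul ha.le, gradNorm_le_ofReal_iff hconn (mul_nonneg ha.le h0)]
  intro x y
  have hlim : Tendsto (fun L : ℝ => L * a * G.d x y) (𝓝[>] (G.gradNorm f).toReal)
      (𝓝 ((G.gradNorm f).toReal * a * G.d x y)) :=
    ((tendsto_id.mono_left nhdsWithin_le_nhds).mul_const _).mul_const _
  rw [mul_comm a]
  refine ge_of_tendsto hlim ?_
  filter_upwards [self_mem_nhdsWithin] with L (hL : _ < L)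
  refine h L (h0.trans_lt hL) ?_ x y
  rw [← gradNorm_le_ofReal_iff hconn (h0.trans hL.le), ← e]
  exact ENNReal.ofReal_le_ofReal hL.le

theorem RicGE.stochasticallyComplete (hfin : G.LocallyFinite) (hconn : G.Connected) {K : ℝ}
    (h : G.RicGE K) : G.StochasticallyComplete := by
  refine stochasticallyComplete_of_const hfin hconn fun t ht x y => ?_
  have hlim : Tendsto (fun L : ℝ => L * Real.exp (-K * t) * G.d x y) (𝓝[>] 0)
      (𝓝 (0 * Real.exp (-K * t) * G.d x y)) :=
    ((tendsto_id.mono_left nhdsWithin_le_nhds).mul_const _).mul_const _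
  rw [zero_mul, zero_mul] at hlim
  rw [← sub_nonpos]
  refine ge_of_tendsto hlim ?_
  filter_upwards [self_mem_nhdsWithin] with L (hL : 0 < L)
  refine h.heatNonneg_sub_le hfin hconn hL (M := 1) (fun _ => zero_le_one) (fun _ => le_rfl)
    (fun p q => ?_) ht.le x y
  rw [sub_self]
  exact mul_nonneg hL.le (d_nonneg p q)

theorem RicGE.gradNorm_heat_le (hfin : G.LocallyFinite) (hconn : G.Connected) {K : ℝ}
    (h : G.RicGE K) {f : V → ℝ} (hf : IsBoundedFun f) {t : ℝ} (ht : 0 < t) :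
    G.gradNorm (G.heat t f) ≤ ENNReal.ofReal (Real.exp (-K * t)) * G.gradNorm f := by
  refine gradNorm_le_mul_of_forall_lt hconn (Real.exp_pos _) fun L hL hlip x y => ?_
  obtain ⟨C, hC⟩ := hf
  have h0 : ∀ z, 0 ≤ (f + C • (1 : V → ℝ)) z := fun z => by
    simp only [Pi.add_apply, Pi.smul_apply, Pi.one_apply, smul_eq_mul, mul_one]
    linarith [(abs_le.1 (hC z)).1]
  have hM : ∀ z, (f + C • (1 : V → ℝ)) z ≤ C + C := fun z => by
    simp only [Pi.add_apply, Pi.smul_apply, Pi.one_apply, smul_eq_mul, mul_one]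
    linarith [(abs_le.1 (hC z)).2]
  have h1 := h.heatNonneg_sub_le hfin hconn hL h0 hM (fun p q => by
    simpa using hlip p q) ht.le x y
  -- By stochastic completeness the added constant drops out.
  rw [← heat_of_nonneg hfin h0 ht.le, heat_add hfin hconn ⟨C, hC⟩ (isBoundedFun_one.smul C) ht.le,
    heat_smul hfin hconn isBoundedFun_one C ht.le, h.stochasticallyComplete hfin hconn t ht] at h1
  simpa using h1

theorem wasserstein_heatKernel_le_iff (hfin : G.LocallyFinite) (hconn : G.Connected) {t : ℝ}
    (ht : 0 ≤ t) (x y : V) (b : ℝ) :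
    G.wasserstein (G.heatKernel t x) (G.heatKernel t y) ≤ (b : EReal) ↔
      ∀ f, G.IsLipOne f → IsBoundedFun f → G.heat t f x - G.heat t f y ≤ b := by
  simp only [wasserstein, iSup_le_iff, and_imp]
  refine forall_congr' fun f => forall_congr' fun _ => forall_congr' fun hb => ?_
  rw [(hasSum_mul_heatKernel hfin hconn hb ht x).tsum_eq,
    (hasSum_mul_heatKernel hfin hconn hb ht y).tsum_eq, EReal.coe_le_coe_iff]

theorem IsFinSupp.isBoundedFun {f : V → ℝ} (hf : IsFinSupp f) : IsBoundedFun f := by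
  obtain ⟨C, hC⟩ := (hf.image fun x => |f x|).bddAbove
  refine ⟨max C 0, fun x => ?_⟩
  by_cases hx : f x = 0
  · rw [hx, abs_zero]; exact le_max_right _ _
  · exact (hC (Set.mem_image_of_mem _ hx)).trans (le_max_left _ _)

end WeightedGraph

end

open WeightedGraph in
theorem theorem3p5 {V : Type*} [Countable V] (G : WeightedGraph V)
    (hfin : G.LocallyFinite) (hconn : G.Connected) (K : ℝ) :
    List.TFAE [
      G.RicGE K,
      ∀ f : V → ℝ, WeightedGraph.IsFinSupp f → ∀ t : ℝ, 0 < t →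
        G.gradNorm (G.heat t f) ≤ ENNReal.ofReal (Real.exp (-K * t)) * G.gradNorm f,
      ∀ f : V → ℝ, WeightedGraph.IsBoundedFun f → ∀ t : ℝ, 0 < t →
        G.gradNorm (G.heat t f) ≤ ENNReal.ofReal (Real.exp (-K * t)) * G.gradNorm f,
      G.StochasticallyComplete ∧ ∀ x y : V, ∀ t : ℝ, 0 < t →
        G.wasserstein (G.heatKernel t x) (G.heatKernel t y) ≤
          ((Real.exp (-K * t) * G.d x y : ℝ) : EReal)] := by
  tfae_have 1 → 3 := fun h f hf t ht => h.gradNorm_heat_le hfin hconn hf ht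
  tfae_have 3 → 2 := fun h f hf t ht => h f hf.isBoundedFun t ht
  tfae_have 2 → 1 := fun h => ricGE_of_eulerStep_sub_le hfin hconn
    (exists_eulerStep_sub_le hfin hconn h)
  tfae_have 3 → 4 := by
    intro h
    refine ⟨stochasticallyComplete_of_const hfin hconn fun t ht x y => ?_, fun x y t ht => ?_⟩
    · have h0 : G.gradNorm (1 : V → ℝ) ≤ ENNReal.ofReal 0 :=
        (gradNorm_le_ofReal_iff hconn le_rfl).2 fun p q => by simp
      rw [ENNReal.ofReal_zero, nonpos_iff_eq_zero] at h0
      have h1 := h 1 isBoundedFun_one t ht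
      rw [h0, mul_zero, ← ENNReal.ofReal_zero, gradNorm_le_ofReal_iff hconn le_rfl,
        heat_of_nonneg (f := 1) hfin (fun _ => zero_le_one) ht.le] at h1
      have := h1 x y
      linarith
    · refine (wasserstein_heatKernel_le_iff hfin hconn ht.le x y _).2 fun f hf hb => ?_
      have h0 : G.gradNorm f ≤ ENNReal.ofReal 1 := (gradNorm_le_ofReal_iff hconn zero_le_one).2
        fun p q => by rw [one_mul]; exact (abs_le.1 (hf p q)).2
      refine (gradNorm_le_ofReal_iff hconn (Real.exp_pos _).le).1 ((h f hb t ht).trans ?_) x y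
      calc _ ≤ ENNReal.ofReal (Real.exp (-K * t)) * ENNReal.ofReal 1 := by gcongr
        _ = _ := by rw [ENNReal.ofReal_one, mul_one]
  tfae_have 4 → 3 := by
    rintro ⟨-, h⟩ f hf t ht
    refine gradNorm_le_mul_of_forall_lt hconn (Real.exp_pos _) fun L hL hlip x y => ?_
    have h1 := (wasserstein_heatKernel_le_iff hfin hconn ht.le x y _).1 (h x y t ht) (L⁻¹ • f)
      (isLipOne_inv_smul hL hlip) (hf.smul _)
    rw [heat_smul hfin hconn hf _ ht.le, Pi.smul_apply, Pi.smul_apply, smul_eq_mul, smul_eq_mul,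
      ← mul_sub, inv_mul_le_iff₀ hL] at h1
    linarith
  tfae_finish
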